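/- An \emph{ordered group} is a pair $(G,G^+)$ with $G$ a countable abelian group and $G^+\subseteq G$ such that $G^++G^+\subseteq G^+$, $G^+\cap(-G^+)=\{0\}$ and $G^+-G^+=G$; write $a\le b$ if $b-a\in G^+$. It is a \emph{simple dimension group} if there are integers $d_i\ge 1$ and integer matrices $A_i$ of size $d_{i+1}\times d_i$ $(i\ge 0)$, all of whose entries are strictly positive, and a group isomorphism from $G$ onto the inductive limit of $\mathbb Z^{d_0}\xrightarrow{A_0}\mathbb Z^{d_1}\xrightarrow{A_1}\mathbb Z^{d_2}\xrightarrow{A_2}\cdots$ that maps $G^+$ onto the set of classes of vectors with non-negative entries. An \emph{order unit} is an element $u\in G^+$ such that for every $a\in G$ there is an integer $k\ge 0$ with $a\le ku$. A \emph{subshift} $(Y,S)$ is a closed shift-invariant set $Y\subseteq\mathcal A^{\mathbb Z}$, with $\mathcal A$ a finite non-empty alphabet, together with the shift $(Sy)_i=y_{i+1}$; it is \emph{minimal} if $Y\neq\emptyset$ and the only closed $S$-invariant subsets of $Y$ are $\emptyset$ and $Y$ (a finite orbit is allowed). Its complexity $p_Y(n)$ is the number of words of length $n$ occurring in elements of $Y$.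 Put $H(Y,S)=C(Y,\mathbb Z)/\{f\circ S-f: f\in C(Y,\mathbb Z)\}$, let $H^+(Y,S)$ be the set of classes of non-negative functions, and let $K^0(Y,S)=(H(Y,S),H^+(Y,S),[1])$. \textbf{Theorem.} Let $(G,G^+)$ be a simple dimension group with an order unit $u$, and let $(p_n)_{n\in\mathbb N}$ be a sequence of positive real numbers with $\lim_{n\to\infty} n/p_n=0$. Then there exists a minimal subshift $(Y,S)$ such that \begin{enumerate} \item $K^0(Y,S)$ and $(G,G^+,u)$ are isomorphic as ordered groups with unit, i.e. there is a group isomorphism $\varphi\colon H(Y,S)\to G$ with $\varphi(H^+(Y,S))=G^+$ and $\varphi([1])=u$; \item $\lim_{n\to\infty} p_Y(n)/p_n=0$. \end{enumerate} -/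

import Mathlib

open Filter Topology SymbolicDynamics.FullShift

noncomputable section

namespace DimGroup

/-! ### Ordered groups with unit -/

/-- `(G, Gp)` is an ordered group: `G` is a countable abelian group and `Gp` is a positive cone,
i.e. `Gp + Gp ⊆ Gp`, `Gp ∩ (-Gp) = {0}` and `Gp - Gp = G`. -/
structure IsOrderedGroup {G : Type*} [AddCommGroup G] (Gp : Set G) : Prop where
  countable : Countable G
  add_mem : ∀ a ∈ Gp, ∀ b ∈ Gp, a + b ∈ Gp
  mem_and_neg_mem : ∀ a, (a ∈ Gp ∧ -a ∈ Gp) ↔ a = 0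
  exists_sub : ∀ g, ∃ a ∈ Gp, ∃ b ∈ Gp, g = a - b

/-- `u` is an order unit: `u ∈ Gp` and each `a` satisfies `a ≤ k u` for some natural number `k`. -/
def IsOrderUnit {G : Type*} [AddCommGroup G] (Gp : Set G) (u : G) : Prop :=
  u ∈ Gp ∧ ∀ a : G, ∃ k : ℕ, k • u - a ∈ Gp

/-- Isomorphism of ordered groups. -/
def OrderedIso {G H : Type*} [AddCommGroup G] [AddCommGroup H] (Gp : Set G) (Hp : Set H) : Prop :=
  ∃ φ : G ≃+ H, φ '' Gp = Hp

/-- Isomorphism of ordered groups with unit. -/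
def OrderedUnitIso {G H : Type*} [AddCommGroup G] [AddCommGroup H]
    (Gp : Set G) (u : G) (Hp : Set H) (v : H) : Prop :=
  ∃ φ : G ≃+ H, φ '' Gp = Hp ∧ φ u = v

/-! ### Inductive limits of integer matrices -/

section Limit

variable (d : ℕ → ℕ) (A : ∀ i, Matrix (Fin (d (i + 1))) (Fin (d i)) ℤ)

/-- The composite `A (j-1) ∘ ⋯ ∘ A i : ℤ ^ d i → ℤ ^ d j`, for `i ≤ j`. -/
def transition (i j : ℕ) (h : i ≤ j) : (Fin (d i) → ℤ) →+ (Fin (d j) → ℤ) :=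
  Nat.leRecOn (C := fun k => (Fin (d i) → ℤ) →+ (Fin (d k) → ℤ)) h
    (fun {k} f => (A k).mulVecLin.toAddMonoidHom.comp f) (AddMonoidHom.id _)

theorem transition_self (i : ℕ) (x : Fin (d i) → ℤ) : transition d A i i le_rfl x = x := by
  simp [transition, Nat.leRecOn_self]

theorem transition_succ (i j : ℕ) (h : i ≤ j) (x : Fin (d i) → ℤ) :
    transition d A i (j + 1) (h.trans j.le_succ) x = (A j).mulVec (transition d A i j h x) := by
  simp [transition, Nat.leRecOn_succ h]

instance transition_directedSystem :
    DirectedSystem (fun i => Fin (d i) → ℤ) (fun i j h => transition d A i j h) where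
  map_self i x := transition_self d A i x
  map_map k j i hij hjk x := by
    induction hjk with
    | refl => exact transition_self d A j _
    | step hjk ih =>
      have h1 := transition_succ d A j _ hjk (transition d A i j hij x)
      have h2 := transition_succ d A i _ (hij.trans hjk) x
      exact h1.trans ((congrArg _ ih).trans h2.symm)

/-- The inductive limit `ℤ ^ d 0 → ℤ ^ d 1 → ℤ ^ d 2 → ⋯` along the matrices `A i`. -/
abbrev LimitGroup : Type :=
  DirectLimit (fun i => Fin (d i) → ℤ) (fun i j h => transition d A i j h)

/-- The class `[x, i]` of `x ∈ ℤ ^ d i` in the inductive limit. -/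
def LimitGroup.mk (i : ℕ) (x : Fin (d i) → ℤ) : LimitGroup d A := ⟦⟨i, x⟩⟧

/-- The induced order: the positive cone consists of the classes of non-negative vectors. -/
def LimitGroup.pos : Set (LimitGroup d A) :=
  {g | ∃ (i : ℕ) (x : Fin (d i) → ℤ), (∀ j, 0 ≤ x j) ∧ LimitGroup.mk d A i x = g}

end Limit

/-- `(G, Gp)` is a dimension group: an ordered group isomorphic to an inductive limit of groups
`ℤ ^ d i`, `d i ≥ 1`, along matrices with non-negative entries. -/
def IsDimensionGroup {G : Type*} [AddCommGroup G] (Gp : Set G) : Prop :=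
  IsOrderedGroup Gp ∧
    ∃ (d : ℕ → ℕ) (A : ∀ i, Matrix (Fin (d (i + 1))) (Fin (d i)) ℤ),
      (∀ i, 1 ≤ d i) ∧ (∀ i j k, 0 ≤ A i j k) ∧ OrderedIso Gp (LimitGroup.pos d A)

/-- A dimension group is simple if the matrices can be chosen with all entries (strictly)
positive. -/
def IsSimpleDimensionGroup {G : Type*} [AddCommGroup G] (Gp : Set G) : Prop :=
  IsDimensionGroup Gp ∧
    ∃ (d : ℕ → ℕ) (A : ∀ i, Matrix (Fin (d (i + 1))) (Fin (d i)) ℤ),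
      (∀ i, 1 ≤ d i) ∧ (∀ i j k, 0 < A i j k) ∧ OrderedIso Gp (LimitGroup.pos d A)

/-! ### Minimal systems and their dimension groups -/

section Dynamics

variable {X : Type*} [TopologicalSpace X] (T : X ≃ₜ X)

/-- `(X, T)` is minimal: `X` is non-empty and has no closed `T`-invariant subset but `∅` and `X`. -/
def IsMinimalSystem : Prop :=
  Nonempty X ∧ ∀ C : Set X, IsClosed C → Set.MapsTo T C C → C = ∅ ∨ C = Set.univ

/-- The coboundary map `f ↦ f ∘ T - f` on `C(X, ℤ)`. -/
def coboundary : C(X, ℤ) →+ C(X, ℤ) where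
  toFun f := f.comp (T : C(X, X)) - f
  map_zero' := by ext x; simp
  map_add' f g := by ext x; simp; ring

/-- The group `H(X, T) = C(X, ℤ) / β C(X, ℤ)`. -/
abbrev K0 : Type _ := C(X, ℤ) ⧸ (coboundary T).range

/-- The classes of the non-negative functions. -/
def K0.pos : Set (K0 T) :=
  {g | ∃ f : C(X, ℤ), (∀ x, 0 ≤ f x) ∧ (QuotientAddGroup.mk f : K0 T) = g}

/-- The class of the constant function `1`. -/
def K0.unit : K0 T := QuotientAddGroup.mk (1 : C(X, ℤ))

end Dynamics

/-! ### Subshifts and complexity -/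

section Subshifts

variable {𝒜 : Type*} [TopologicalSpace 𝒜] (Y : Subshift 𝒜 ℤ)

/-- The shift `(S y) i = y (i + 1)`, as a homeomorphism of the subshift `Y`. -/
def shiftMap : Y.carrier ≃ₜ Y.carrier where
  toFun y := ⟨shift 1 y.1, Y.mapsTo 1 y.2⟩
  invFun y := ⟨shift (-1) y.1, Y.mapsTo (-1) y.2⟩
  left_inv y := by ext i; simp
  right_inv y := by ext i; simp
  continuous_toFun := by fun_prop
  continuous_invFun := by fun_prop

/-- The words of length `n` that occur in some element of `Y`. -/
def language (n : ℕ) : Set (Fin n → 𝒜) :=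
  {w | ∃ y ∈ Y.carrier, ∃ i : ℤ, ∀ k : Fin n, w k = y (i + (k : ℕ))}

/-- The complexity `p_Y(n)`: the number of words of length `n` in the language of `Y`. -/
def complexity (n : ℕ) : ℕ := (language Y n).ncard

end Subshifts

end DimGroup

end

/-!
Realise `G` as a limit of positive integer matrices. If from some level on every matrix is the
`1 × 1` matrix `1`, then `G` is `ℤ` and a periodic orbit does the job. Otherwise every nonzero
positive element can be written with arbitrarily large coprime multiplicities, and refining the
diagram accordingly makes all multiplicities as large as desired while the rows of each matrix
become distinct.

Stack the towers of level `n` into those of level `n + 1`: the tower `b` is the concatenation, for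
`a = 0, 1, …`, of as many copies of the tower `a` as the `(b, a)` entry of the `n`-th matrix.
Distinct rows make the tower partitions recognizable from the base letters, so the orbits form a
minimal subshift whose `K⁰` is the limit of the matrices, the unit being the vector of initial
heights. A word shorter than every run of copies of a single tower of level `n` sees at most one
change of tower, so the complexity grows linearly there, with a constant depending only on the
number of towers of the levels `n` and `n + 1`; as `n / p n → 0`, large enough multiplicities make
it `o(p n)`.
-/

noncomputable section

namespace DimGroup

/-! ### Bratteli diagrams -/

/-- A Bratteli diagram: level `n` has the vertices `0, …, width n - 1`, and `mult n b a` edges join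
the vertex `a` of level `n` to the vertex `b` of level `n + 1`. The values of `mult` at indices
that are not vertices are irrelevant, but have to be positive too, which saves side conditions. -/
structure BratteliDiagram where
  width : ℕ → ℕ
  mult : ℕ → ℕ → ℕ → ℕ
  width_pos : ∀ n, 0 < width n
  mult_pos : ∀ n b a, 0 < mult n b a

namespace BratteliDiagram

section Limit

variable (B : BratteliDiagram)

/-- Multiplication by the incidence matrix from level `n` to level `n + 1`. Vectors are functions
on `ℕ`, of which only the coordinates that are vertices matter. -/
def push (n : ℕ) : (ℕ → ℤ) →+ (ℕ → ℤ) where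
  toFun x b := ∑ a ∈ Finset.range (B.width n), B.mult n b a * x a
  map_zero' := by ext; simp
  map_add' x y := by ext; simp [mul_add, Finset.sum_add_distrib]

/-- The product of the incidence matrices from level `n` to level `n + k`. -/
def pushIter (n : ℕ) : ℕ → (ℕ → ℤ) →+ (ℕ → ℤ)
  | 0 => AddMonoidHom.id _
  | k + 1 => (B.push (n + k)).comp (pushIter n k)

/-- The element `∑ a, x a • γ n a` of `M` that is represented by the vector `x` of level `n`. -/
def eval {M : Type*} [AddCommGroup M] (γ : ℕ → ℕ → M) (n : ℕ) : (ℕ → ℤ) →+ M where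
  toFun x := ∑ a ∈ Finset.range (B.width n), x a • γ n a
  map_zero' := by simp
  map_add' x y := by simp [add_smul, Finset.sum_add_distrib]

/-- The relations between the generators of consecutive levels of the dimension group. -/
def Compatible {M : Type*} [AddCommGroup M] (γ : ℕ → ℕ → M) : Prop :=
  ∀ n, ∀ a < B.width n,
    γ n a = ∑ b ∈ Finset.range (B.width (n + 1)), B.mult n b a • γ (n + 1) b

/-- The elements `γ n a` identify `M`, with the positive cone `P`, with the limit of the groups of
integer vectors along the incidence matrices of the diagram. -/
structure Represents {M : Type*} [AddCommGroup M] (γ : ℕ → ℕ → M) (P : Set M) : Prop where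
  compatible : B.Compatible γ
  exists_eval_eq : ∀ g, ∃ n x, B.eval γ n x = g
  mem_iff : ∀ g, g ∈ P ↔ ∃ n x, (∀ a < B.width n, 0 ≤ x a) ∧ B.eval γ n x = g
  eventually_zero : ∀ n x, B.eval γ n x = 0 →
    ∃ k, ∀ b < B.width (n + k), B.pushIter n k x b = 0

variable {B} {M M' : Type*} [AddCommGroup M] [AddCommGroup M'] {γ : ℕ → ℕ → M} {P : Set M}
  {γ' : ℕ → ℕ → M'} {P' : Set M'}

theorem push_apply (n : ℕ) (x : ℕ → ℤ) (b : ℕ) :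
    B.push n x b = ∑ a ∈ Finset.range (B.width n), B.mult n b a * x a := rfl

theorem pushIter_succ (n k : ℕ) (x : ℕ → ℤ) :
    B.pushIter n (k + 1) x = B.push (n + k) (B.pushIter n k x) := rfl

theorem eval_apply (n : ℕ) (x : ℕ → ℤ) :
    B.eval γ n x = ∑ a ∈ Finset.range (B.width n), x a • γ n a := rfl

theorem eval_congr {n : ℕ} {x y : ℕ → ℤ} (h : ∀ a < B.width n, x a = y a) :
    B.eval γ n x = B.eval γ n y := by
  rw [eval_apply, eval_apply]
  exact Finset.sum_congr rfl fun a ha => by rw [h a (Finset.mem_range.1 ha)]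

theorem map_eval (φ : M →+ M') (n : ℕ) (x : ℕ → ℤ) :
    φ (B.eval γ n x) = B.eval (fun n a => φ (γ n a)) n x := by
  simp [eval_apply]

theorem Compatible.eval_push (hγ : B.Compatible γ) (n : ℕ) (x : ℕ → ℤ) :
    B.eval γ (n + 1) (B.push n x) = B.eval γ n x := by
  simp_rw [eval_apply, push_apply, Finset.sum_smul]
  rw [Finset.sum_comm]
  refine Finset.sum_congr rfl fun a ha => ?_
  rw [hγ n a (Finset.mem_range.1 ha), Finset.smul_sum]
  exact Finset.sum_congr rfl fun b _ => by rw [mul_comm, mul_smul, natCast_zsmul]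

theorem Compatible.eval_pushIter (hγ : B.Compatible γ) (n k : ℕ) (x : ℕ → ℤ) :
    B.eval γ (n + k) (B.pushIter n k x) = B.eval γ n x := by
  induction k with
  | zero => rfl
  | succ k ih => rw [pushIter_succ, ← add_assoc, hγ.eval_push, ih]

theorem Compatible.range_eval_mono (hγ : B.Compatible γ) :
    Monotone fun n => (B.eval γ n).range :=
  monotone_nat_of_le_succ fun n => by
    rintro _ ⟨x, rfl⟩
    exact ⟨B.push n x, hγ.eval_push n x⟩

theorem Compatible.prodMk (hγ : B.Compatible γ) (hγ' : B.Compatible γ') :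
    B.Compatible fun n a => (γ n a, γ' n a) := fun n a ha => by
  ext
  · simpa [Prod.fst_sum] using hγ n a ha
  · simpa [Prod.snd_sum] using hγ' n a ha

theorem Compatible.map (hγ : B.Compatible γ) (φ : M →+ M') :
    B.Compatible fun n a => φ (γ n a) := fun n a ha => by
  simp [hγ n a ha]

theorem eval_prodMk (n : ℕ) (x : ℕ → ℤ) :
    B.eval (fun n a => (γ n a, γ' n a)) n x = (B.eval γ n x, B.eval γ' n x) :=
  Prod.ext (map_eval (AddMonoidHom.fst M M') n x) (map_eval (AddMonoidHom.snd M M') n x)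

theorem Represents.eval_eq_zero (h : B.Represents γ P) (hγ' : B.Compatible γ') {n : ℕ}
    {x : ℕ → ℤ} (hx : B.eval γ n x = 0) : B.eval γ' n x = 0 := by
  obtain ⟨k, hk⟩ := h.eventually_zero n x hx
  rw [← hγ'.eval_pushIter n k, eval_congr (y := 0) hk, map_zero]

theorem Represents.map (h : B.Represents γ P) (φ : M ≃+ M') :
    B.Represents (fun n a => φ (γ n a)) (φ '' P) where
  compatible := h.compatible.map φ.toAddMonoidHom
  exists_eval_eq g := by
    obtain ⟨n, x, hx⟩ := h.exists_eval_eq (φ.symm g)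
    exact ⟨n, x, by rw [← φ.apply_symm_apply g, ← hx]; exact (map_eval φ.toAddMonoidHom n x).symm⟩
  mem_iff g := by
    constructor
    · rintro ⟨g, hg, rfl⟩
      obtain ⟨n, x, hx, rfl⟩ := (h.mem_iff g).1 hg
      exact ⟨n, x, hx, (map_eval φ.toAddMonoidHom n x).symm⟩
    · rintro ⟨n, x, hx, rfl⟩
      exact ⟨_, (h.mem_iff _).2 ⟨n, x, hx, rfl⟩, map_eval φ.toAddMonoidHom n x⟩
  eventually_zero n x hx := by
    refine h.eventually_zero n x (φ.injective ?_)
    rw [map_zero, ← hx]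
    exact map_eval φ.toAddMonoidHom n x

theorem Represents.exists_addEquiv (h : B.Represents γ P) (h' : B.Represents γ' P') :
    ∃ φ : M ≃+ M', φ '' P = P' ∧ ∀ n x, φ (B.eval γ n x) = B.eval γ' n x := by
  have hprod := h.compatible.prodMk h'.compatible
  let R : AddSubgroup (M × M') := ⨆ n, (B.eval (fun n a => (γ n a, γ' n a)) n).range
  have mem_R : ∀ p, p ∈ R ↔ ∃ n x, (B.eval γ n x, B.eval γ' n x) = p := fun p => by
    simp only [R, AddSubgroup.mem_iSup_of_directed hprod.range_eval_mono.directed_le,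
      AddMonoidHom.mem_range, eval_prodMk]
  have bijective_fst : Function.Bijective (Prod.fst ∘ R.subtype) := by
    refine ⟨(injective_iff_map_eq_zero ((AddMonoidHom.fst M M').comp R.subtype)).2 ?_, fun g => ?_⟩
    · rintro ⟨_, hp⟩ h0
      obtain ⟨n, x, rfl⟩ := (mem_R _).1 hp
      exact Subtype.ext (Prod.ext h0 (h.eval_eq_zero h'.compatible h0))
    · obtain ⟨n, x, rfl⟩ := h.exists_eval_eq g
      exact ⟨⟨_, (mem_R _).2 ⟨n, x, rfl⟩⟩, rfl⟩
  have bijective_snd : Function.Bijective (Prod.snd ∘ R.subtype) := by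
    refine ⟨(injective_iff_map_eq_zero ((AddMonoidHom.snd M M').comp R.subtype)).2 ?_, fun g => ?_⟩
    · rintro ⟨_, hp⟩ h0
      obtain ⟨n, x, rfl⟩ := (mem_R _).1 hp
      exact Subtype.ext (Prod.ext (h'.eval_eq_zero h.compatible h0) h0)
    · obtain ⟨n, x, rfl⟩ := h'.exists_eval_eq g
      exact ⟨⟨_, (mem_R _).2 ⟨n, x, rfl⟩⟩, rfl⟩
  obtain ⟨φ, hφ⟩ := AddSubgroup.exists_addEquiv_eq_graph bijective_fst bijective_snd
  have φ_eval : ∀ n x, φ (B.eval γ n x) = B.eval γ' n x := fun n x => by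
    have hmem := (mem_R _).2 ⟨n, x, rfl⟩
    rw [hφ] at hmem
    exact hmem
  refine ⟨φ, Set.ext fun g => ⟨?_, fun hg => ?_⟩, φ_eval⟩
  · rintro ⟨g, hg, rfl⟩
    obtain ⟨n, x, hx, rfl⟩ := (h.mem_iff g).1 hg
    exact (h'.mem_iff _).2 ⟨n, x, hx, (φ_eval n x).symm⟩
  · obtain ⟨n, x, hx, rfl⟩ := (h'.mem_iff g).1 hg
    exact ⟨_, (h.mem_iff _).2 ⟨n, x, hx, rfl⟩, φ_eval n x⟩

end Limit

section OfMatrices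

variable {d : ℕ → ℕ} {A : ∀ i, Matrix (Fin (d (i + 1))) (Fin (d i)) ℤ}
  (hd : ∀ i, 1 ≤ d i) (hA : ∀ i j k, 0 < A i j k)

/-- The Bratteli diagram with the incidence matrices `A i`. -/
def ofMatrices : BratteliDiagram where
  width := d
  mult n b a := if h : b < d (n + 1) ∧ a < d n then (A n ⟨b, h.1⟩ ⟨a, h.2⟩).toNat else 1
  width_pos := hd
  mult_pos n b a := by
    split_ifs with h
    · exact Int.pos_iff_toNat_pos.1 (hA n _ _)
    · exact one_pos

theorem ofMatrices_push (n : ℕ) (x : ℕ → ℤ) (b : Fin (d (n + 1))) :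
    (ofMatrices hd hA).push n x b = (A n).mulVec (fun a => x a) b := by
  rw [push_apply, ofMatrices, Finset.sum_range]
  refine Finset.sum_congr rfl fun a _ => ?_
  simp [(hA n b a).le]

theorem ofMatrices_pushIter (n k : ℕ) (x : ℕ → ℤ) :
    (fun b : Fin (d (n + k)) => (ofMatrices hd hA).pushIter n k x b) =
      transition d A n (n + k) (n.le_add_right k) fun a => x a := by
  induction k with
  | zero => exact (transition_self d A n _).symm
  | succ k ih =>
    refine Eq.trans ?_ (transition_succ d A n (n + k) (n.le_add_right k) fun a => x a).symm
    rw [← ih]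
    exact funext fun b => ofMatrices_push hd hA (n + k) _ b

variable (d A) in
/-- The homomorphism that maps a vector of level `n` to its class in the inductive limit. -/
def limitClass (n : ℕ) : (ℕ → ℤ) →+ LimitGroup d A :=
  AddMonoidHom.mk' (fun x => LimitGroup.mk d A n fun a => x a) fun x y =>
    (DirectLimit.add_def (G := fun i => Fin (d i) → ℤ) (f := fun i j h => transition d A i j h)
      n (fun a => x a) (fun a => y a)).symm

theorem limitClass_extend (n : ℕ) (x : Fin (d n) → ℤ) :
    limitClass d A n (Function.extend Fin.val x 0) = LimitGroup.mk d A n x :=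
  congrArg (LimitGroup.mk d A n) (Function.extend_comp Fin.val_injective x 0)

theorem limitClass_push (n : ℕ) (x : ℕ → ℤ) :
    limitClass d A (n + 1) ((ofMatrices hd hA).push n x) = limitClass d A n x := by
  have h := ofMatrices_pushIter hd hA n 1 x
  exact (congrArg (LimitGroup.mk d A (n + 1)) h).trans
    (DirectLimit.mk_apply (f := fun i j h => transition d A i j h) n (n + 1) _ n.le_succ)

theorem limitClass_eq_eval (n : ℕ) (x : ℕ → ℤ) :
    limitClass d A n x =
      (ofMatrices hd hA).eval (fun n a => limitClass d A n (Pi.single a 1)) n x := by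
  have hx : ∀ c : Fin (d n), (∑ a ∈ Finset.range (d n), x a • (Pi.single a 1 : ℕ → ℤ)) c = x c := by
    intro c
    simp [Finset.sum_apply, Pi.single_apply]
  simp only [eval_apply, ← map_zsmul, ← map_sum]
  exact congrArg (LimitGroup.mk d A n) (funext fun c => (hx c).symm)

theorem represents_limitGroup :
    (ofMatrices hd hA).Represents (fun n a => limitClass d A n (Pi.single a 1))
      (LimitGroup.pos d A) where
  compatible n a ha := by
    dsimp only
    rw [← limitClass_push hd hA, limitClass_eq_eval hd hA (n + 1), eval_apply]
    refine Finset.sum_congr rfl fun b _ => ?_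
    rw [push_apply, Finset.sum_eq_single_of_mem a (Finset.mem_range.2 ha)
      fun c _ hc => by rw [Pi.single_eq_of_ne hc, mul_zero], Pi.single_eq_same, mul_one,
      natCast_zsmul]
  exists_eval_eq g := by
    simp only [← limitClass_eq_eval]
    induction g using DirectLimit.induction with | _ n x
    exact ⟨n, _, limitClass_extend n x⟩
  mem_iff g := by
    simp only [← limitClass_eq_eval]
    constructor
    · rintro ⟨n, x, hx, rfl⟩
      refine ⟨n, _, fun a ha => ?_, limitClass_extend n x⟩
      exact (hx ⟨a, ha⟩).trans_eq (Fin.val_injective.extend_apply x 0 ⟨a, ha⟩).symm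
    · rintro ⟨n, x, hx, rfl⟩
      exact ⟨n, _, fun a => hx a a.2, rfl⟩
  eventually_zero n x hx := by
    rw [← limitClass_eq_eval] at hx
    obtain ⟨m, hm, h0⟩ := (DirectLimit.exists_eq_zero (G := fun i => Fin (d i) → ℤ)
      (f := fun i j h => transition d A i j h) ⟨n, fun a => x a⟩).1 hx
    obtain ⟨k, rfl⟩ := Nat.exists_eq_add_of_le hm
    refine ⟨k, fun b hb => ?_⟩
    have h1 := congrFun (ofMatrices_pushIter hd hA n k x) ⟨b, hb⟩
    exact h1.trans (congrFun h0 _)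

end OfMatrices

end BratteliDiagram

theorem IsSimpleDimensionGroup.exists_represents {G : Type*} [AddCommGroup G] {Gp : Set G}
    (hG : IsSimpleDimensionGroup Gp) :
    ∃ (B : BratteliDiagram) (γ : ℕ → ℕ → G), B.Represents γ Gp := by
  obtain ⟨-, d, A, hd, hA, φ, hφ⟩ := hG
  have h := (BratteliDiagram.represents_limitGroup hd hA).map φ.symm
  rw [← hφ, ← Set.image_comp] at h
  exact ⟨_, _, by simpa using h⟩

/-! ### Growth of the entries -/

theorem exists_pos_add_mul_eq {p q n : ℕ} (hpq : p.Coprime q) (hn : p * q + p + q ≤ n) :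
    ∃ x y : ℕ, 0 < x ∧ 0 < y ∧ p * x + q * y = n := by
  obtain ⟨a, b, hab⟩ := Nat.exists_add_mul_eq_of_gcd_dvd_of_mul_pred_le p q (n - p - q)
    (by simp [hpq.gcd_eq_one])
    ((Nat.mul_le_mul (Nat.pred_le p) (Nat.pred_le q)).trans (by omega))
  have hsub : n - p - q + (p + q) = n := by omega
  exact ⟨a + 1, b + 1, by omega, by omega, by linarith⟩

namespace BratteliDiagram

section Growth

variable {B : BratteliDiagram} {M : Type*} [AddCommGroup M] {γ : ℕ → ℕ → M} {P : Set M} {n : ℕ}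
  {m : ℤ} {x : ℕ → ℤ}

theorem mul_le_push (hx : ∀ a < B.width n, m ≤ x a) (b : ℕ) :
    (∑ a ∈ Finset.range (B.width n), B.mult n b a : ℕ) * m ≤ B.push n x b := by
  rw [push_apply, Nat.cast_sum, Finset.sum_mul]
  exact Finset.sum_le_sum fun a ha =>
    mul_le_mul_of_nonneg_left (hx a (Finset.mem_range.1 ha)) (by positivity)

theorem mult_le_sum (b : ℕ) {a : ℕ} (ha : a < B.width n) :
    B.mult n b a ≤ ∑ a ∈ Finset.range (B.width n), B.mult n b a :=
  Finset.single_le_sum (f := B.mult n b) (fun _ _ => Nat.zero_le _) (Finset.mem_range.2 ha)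

theorem le_push (hm : 0 ≤ m) (hx : ∀ a < B.width n, m ≤ x a) (b : ℕ) : m ≤ B.push n x b := by
  refine (le_mul_of_one_le_left hm ?_).trans (mul_le_push hx b)
  exact_mod_cast (B.mult_pos n b 0).trans_le (mult_le_sum b (B.width_pos n))

theorem one_le_push (hx : ∀ a < B.width n, 0 ≤ x a) (hx0 : ∃ a < B.width n, x a ≠ 0) (b : ℕ) :
    1 ≤ B.push n x b := by
  obtain ⟨a, ha, hxa⟩ := hx0
  calc (1 : ℤ) ≤ B.mult n b a * x a :=
        one_le_mul_of_one_le_of_one_le (by exact_mod_cast B.mult_pos n b a)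
          ((hx a ha).lt_of_ne' hxa)
    _ ≤ B.push n x b := Finset.single_le_sum (f := fun a => (B.mult n b a : ℤ) * x a)
      (fun c hc => mul_nonneg (by positivity) (hx c (Finset.mem_range.1 hc)))
      (Finset.mem_range.2 ha)

theorem pushIter_eq_zero_of_le {k l : ℕ} (hkl : k ≤ l)
    (hk : ∀ b < B.width (n + k), B.pushIter n k x b = 0) :
    ∀ b < B.width (n + l), B.pushIter n l x b = 0 := by
  induction l, hkl using Nat.le_induction with
  | base => exact hk
  | succ l _ ih =>
    intro b _
    rw [pushIter_succ, push_apply]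
    exact Finset.sum_eq_zero fun a ha => by rw [ih a (Finset.mem_range.1 ha), mul_zero]

theorem le_pushIter (hm : 0 ≤ m) (hx : ∀ a < B.width n, m ≤ x a) (k : ℕ) :
    ∀ b < B.width (n + k), m ≤ B.pushIter n k x b := by
  induction k with
  | zero => exact hx
  | succ k ih => exact fun b _ => le_push hm ih b

variable (B) in
/-- The elements represented by a vector of level `n` whose coordinates are at least `m`. -/
def lowerCone (γ : ℕ → ℕ → M) (n : ℕ) (m : ℤ) : Set M :=
  {g | ∃ x, (∀ a < B.width n, m ≤ x a) ∧ B.eval γ n x = g}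

theorem Compatible.lowerCone_mono (hγ : B.Compatible γ) (hm : 0 ≤ m) :
    Monotone fun n => B.lowerCone γ n m :=
  monotone_nat_of_le_succ fun n => by
    rintro _ ⟨x, hx, rfl⟩
    exact ⟨B.push n x, fun b _ => le_push hm hx b, hγ.eval_push n x⟩

theorem Compatible.eventually_mem_lowerCone (hγ : B.Compatible γ) (hm : 0 ≤ m) {g : M}
    (hg : g ∈ B.lowerCone γ n m) : ∀ᶠ l in atTop, g ∈ B.lowerCone γ l m :=
  eventually_atTop.2 ⟨n, fun _ hl => hγ.lowerCone_mono hm hl hg⟩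

namespace Represents

theorem eventually_mem_lowerCone_zero (h : B.Represents γ P) {g : M} (hg : g ∈ P) :
    ∀ᶠ l in atTop, g ∈ B.lowerCone γ l 0 := by
  obtain ⟨n, hn⟩ := (h.mem_iff g).1 hg
  exact h.compatible.eventually_mem_lowerCone le_rfl hn

theorem eventually_mem_lowerCone_one (h : B.Represents γ P) {g : M} (hg : g ∈ P) (hg0 : g ≠ 0) :
    ∀ᶠ l in atTop, g ∈ B.lowerCone γ l 1 := by
  obtain ⟨n, x, hx, rfl⟩ := (h.mem_iff g).1 hg
  have hx0 : ∃ a < B.width n, x a ≠ 0 := by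
    by_contra! hall
    exact hg0 (by rw [eval_congr (y := 0) hall, map_zero])
  exact h.compatible.eventually_mem_lowerCone (n := n + 1) zero_le_one
    ⟨B.push n x, fun b _ => one_le_push hx hx0 b, h.compatible.eval_push n x⟩

theorem eventually_exists_eval_eq (h : B.Represents γ P) (g : M) :
    ∀ᶠ l in atTop, ∃ x, (g ∈ P → ∀ b < B.width l, 0 ≤ x b) ∧ B.eval γ l x = g := by
  by_cases hg : g ∈ P
  · filter_upwards [h.eventually_mem_lowerCone_zero hg] with l ⟨x, hx, hxg⟩
    exact ⟨x, fun _ => hx, hxg⟩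
  · obtain ⟨n, x, rfl⟩ := h.exists_eval_eq g
    filter_upwards [eventually_ge_atTop n] with l hl
    obtain ⟨k, rfl⟩ := Nat.exists_eq_add_of_le hl
    exact ⟨B.pushIter n k x, fun hg' => absurd hg' hg, h.compatible.eval_pushIter n k x⟩

theorem pos_of_mem_lowerCone_one (h : B.Represents γ P) {g : M} (hg : g ∈ B.lowerCone γ n 1) :
    g ∈ P ∧ g ≠ 0 := by
  obtain ⟨x, hx, rfl⟩ := hg
  refine ⟨(h.mem_iff _).2 ⟨n, x, fun a ha => zero_le_one.trans (hx a ha), rfl⟩, fun h0 => ?_⟩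
  obtain ⟨k, hk⟩ := h.eventually_zero n x h0
  have h1 := le_pushIter zero_le_one hx k 0 (B.width_pos _)
  rw [hk 0 (B.width_pos _)] at h1
  exact absurd h1 (by norm_num)

theorem generator_pos (h : B.Represents γ P) {a : ℕ} (ha : a < B.width n) :
    γ n a ∈ P ∧ γ n a ≠ 0 := by
  refine h.pos_of_mem_lowerCone_one (n := n + 1) ⟨fun b => B.mult n b a, fun b _ => ?_, ?_⟩
  · exact Int.natCast_pos.2 (B.mult_pos n b a)
  · simp [h.compatible n a ha, eval_apply]

end Represents

variable (B) in
/-- Infinitely many incidence matrices have all row sums at least `2`. This characterizes the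
diagrams whose dimension group is not cyclic. -/
def Growing : Prop :=
  ∀ n₀, ∃ n ≥ n₀, ∀ b < B.width (n + 1), 2 ≤ ∑ a ∈ Finset.range (B.width n), B.mult n b a

theorem exists_width_eq_one_of_not_growing (hB : ¬ B.Growing) :
    ∃ n₀, ∀ n ≥ n₀, B.width n = 1 ∧ B.mult n 0 0 = 1 := by
  simp only [Growing, not_forall, not_exists, not_and] at hB
  obtain ⟨n₀, hn₀⟩ := hB
  have row_sum : ∀ n ≥ n₀, ∃ b < B.width (n + 1), B.width n = 1 ∧ B.mult n b 0 = 1 := by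
    intro n hn
    obtain ⟨b, hb, hsum⟩ := hn₀ n hn
    have hwidth : B.width n ≤ ∑ a ∈ Finset.range (B.width n), B.mult n b a := by
      simpa using Finset.card_nsmul_le_sum (Finset.range (B.width n)) (B.mult n b) 1
        fun a _ => B.mult_pos n b a
    have := B.width_pos n
    have := B.mult_pos n b 0
    have := mult_le_sum b (B.width_pos n)
    exact ⟨b, hb, by omega, by omega⟩
  refine ⟨n₀, fun n hn => ?_⟩
  obtain ⟨b, hb, hw, hmult⟩ := row_sum n hn
  obtain ⟨-, -, hw', -⟩ := row_sum (n + 1) (by omega)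
  obtain rfl : b = 0 := by omega
  exact ⟨hw, hmult⟩

theorem Growing.eventually_mem_lowerCone_two_mul (hB : B.Growing) (hγ : B.Compatible γ)
    (hm : 0 ≤ m) {g : M} (hg : ∀ᶠ l in atTop, g ∈ B.lowerCone γ l m) :
    ∀ᶠ l in atTop, g ∈ B.lowerCone γ l (2 * m) := by
  obtain ⟨n₀, hn₀⟩ := eventually_atTop.1 hg
  obtain ⟨n, hn, hsum⟩ := hB n₀
  obtain ⟨x, hx, rfl⟩ := hn₀ n hn
  refine hγ.eventually_mem_lowerCone (n := n + 1) (by positivity)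
    ⟨B.push n x, fun b hb => ?_, hγ.eval_push n x⟩
  exact (mul_le_mul_of_nonneg_right (by exact_mod_cast hsum b hb) hm).trans (mul_le_push hx b)

theorem Represents.eventually_mem_lowerCone (h : B.Represents γ P) (hB : B.Growing) {g : M}
    (hg : g ∈ P) (hg0 : g ≠ 0) (N : ℕ) : ∀ᶠ l in atTop, g ∈ B.lowerCone γ l N := by
  have hpow : ∀ᶠ l in atTop, g ∈ B.lowerCone γ l (2 ^ N) := by
    induction N with
    | zero => simpa using h.eventually_mem_lowerCone_one hg hg0
    | succ N ih =>
      rw [pow_succ']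
      exact hB.eventually_mem_lowerCone_two_mul h.compatible (by positivity) ih
  filter_upwards [hpow] with l ⟨x, hx, hxg⟩
  exact ⟨x, fun a ha => le_trans (by exact_mod_cast N.lt_two_pow_self.le) (hx a ha), hxg⟩

theorem Represents.exists_split (h : B.Represents γ P) (hB : B.Growing) {g : M} (hg : g ∈ P)
    (hg0 : g ≠ 0) {p q : ℕ} (hpq : p.Coprime q) :
    ∃ g₀ g₁ : M, (g₀ ∈ P ∧ g₀ ≠ 0) ∧ (g₁ ∈ P ∧ g₁ ≠ 0) ∧ g = p • g₀ + q • g₁ := by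
  obtain ⟨l, x, hx, rfl⟩ := (h.eventually_mem_lowerCone hB hg hg0 (p * q + p + q)).exists
  have split_coord : ∀ b, ∃ y z : ℤ, b < B.width l → 1 ≤ y ∧ 1 ≤ z ∧ x b = p * y + q * z := by
    intro b
    by_cases hb : b < B.width l
    · have hxb := hx b hb
      lift x b to ℕ using (Int.natCast_nonneg _).trans hxb with c
      obtain ⟨y, z, hy, hz, rfl⟩ := exists_pos_add_mul_eq hpq (by exact_mod_cast hxb : _ ≤ c)
      exact ⟨y, z, fun _ => ⟨by exact_mod_cast hy, by exact_mod_cast hz, by push_cast; rfl⟩⟩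
    · exact ⟨0, 0, fun hb' => absurd hb' hb⟩
  choose y z hyz using split_coord
  refine ⟨B.eval γ l y, B.eval γ l z,
    h.pos_of_mem_lowerCone_one ⟨y, fun b hb => (hyz b hb).1, rfl⟩,
    h.pos_of_mem_lowerCone_one ⟨z, fun b hb => (hyz b hb).2.1, rfl⟩, ?_⟩
  rw [← map_nsmul, ← map_nsmul, ← map_add]
  refine eval_congr fun b hb => ?_
  simp [(hyz b hb).2.2]

end Growth

section Refinement

variable {B : BratteliDiagram} {M : Type*} [AddCommGroup M] {γ : ℕ → ℕ → M} {P : Set M}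

/-- The kernel of `x ↦ ∑ a, x a • g a` is finitely generated, hence dies at a finite level. -/
theorem Represents.exists_kernel_level (h : B.Represents γ P) (n : ℕ) {r : ℕ} (w : ℕ → ℕ → ℤ) :
    ∃ k, ∀ x : ℕ → ℤ, ∑ a ∈ Finset.range r, x a • B.eval γ n (w a) = 0 →
      ∀ b < B.width (n + k), ∑ a ∈ Finset.range r, B.pushIter n k (w a) b * x a = 0 := by
  let L : (Fin r → ℤ) →ₗ[ℤ] (ℕ → ℤ) := Fintype.linearCombination ℤ fun a : Fin r => w a
  let V : ℕ →o Submodule ℤ (Fin r → ℤ) :=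
    { toFun := fun k =>
        { carrier := {x | ∀ b < B.width (n + k), B.pushIter n k (L x) b = 0}
          zero_mem' := by simp
          add_mem' := fun hx hy b hb => by simp [hx b hb, hy b hb]
          smul_mem' := fun c x hx b hb => by
            rw [map_smul, map_zsmul, Pi.smul_apply, hx b hb, smul_zero] }
      monotone' := fun k l hkl x hx => pushIter_eq_zero_of_le hkl hx }
  obtain ⟨k, hk⟩ := monotone_stabilizes_iff_noetherian.2 inferInstance V
  refine ⟨k, fun x hx b hb => ?_⟩
  have hLx : L (fun a => x a) = ∑ a ∈ Finset.range r, x a • w a := by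
    rw [Finset.sum_range]; rfl
  obtain ⟨l, hl⟩ := h.eventually_zero n (L fun a => x a) (by
    rw [hLx, map_sum, ← hx]
    exact Finset.sum_congr rfl fun a _ => map_zsmul _ _ _)
  have hmem : (fun a : Fin r => x a) ∈ V k := by
    have : (fun a : Fin r => x a) ∈ V (max k l) :=
      pushIter_eq_zero_of_le (le_max_right k l) hl
    rwa [← hk _ (le_max_left k l)] at this
  rw [← hmem b hb, hLx, map_sum, Finset.sum_apply]
  exact Finset.sum_congr rfl fun a _ => by
    rw [map_zsmul, Pi.smul_apply, smul_eq_mul, mul_comm]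

/-- The elements `g 0, …, g (r - 1)` are the combinations with coefficients `N b a` of
`g' 0, …, g' (s - 1)`, and each relation between the former holds for the coefficients. -/
structure IsRefinement {M : Type*} [AddCommGroup M] (r : ℕ) (g : ℕ → M) (s : ℕ) (g' : ℕ → M)
    (N : ℕ → ℕ → ℕ) : Prop where
  mult_pos : ∀ b a, 0 < N b a
  eq_sum : ∀ a < r, g a = ∑ b ∈ Finset.range s, N b a • g' b
  relation : ∀ x : ℕ → ℤ, ∑ a ∈ Finset.range r, x a • g a = 0 →
    ∀ b < s, ∑ a ∈ Finset.range r, N b a * x a = 0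

/-- The representative `y` of a further element `q` lets a sequence of refinements exhaust the
whole group. -/
theorem Represents.exists_isRefinement (h : B.Represents γ P) {r : ℕ} {g : ℕ → M}
    (hg : ∀ a < r, g a ∈ P ∧ g a ≠ 0) (q : M) :
    ∃ s g' N, 0 < s ∧ (∀ b < s, g' b ∈ P ∧ g' b ≠ 0) ∧ IsRefinement r g s g' N ∧
      ∃ y : ℕ → ℤ, (q ∈ P → ∀ b < s, 0 ≤ y b) ∧ q = ∑ b ∈ Finset.range s, y b • g' b := by
  have eventually_g : ∀ᶠ l in atTop, ∀ a ∈ Finset.range r, g a ∈ B.lowerCone γ l 1 :=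
    (Finset.range r).eventually_all.2 fun a ha =>
      h.eventually_mem_lowerCone_one (hg a (Finset.mem_range.1 ha)).1
        (hg a (Finset.mem_range.1 ha)).2
  obtain ⟨l₀, hl₀⟩ := eventually_atTop.1 (h.eventually_exists_eval_eq q)
  obtain ⟨l, hl, hll₀⟩ := (eventually_g.and (eventually_ge_atTop l₀)).exists
  choose! w hw using fun a (ha : a < r) => hl a (Finset.mem_range.2 ha)
  obtain ⟨k, hk⟩ := h.exists_kernel_level l (r := r) w
  obtain ⟨y, hy, hyq⟩ := hl₀ (l + k) (by omega)
  let N : ℕ → ℕ → ℕ := fun b a => max 1 (B.pushIter l k (w a) b).toNat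
  have hN : ∀ b < B.width (l + k), ∀ a < r, (N b a : ℤ) = B.pushIter l k (w a) b :=
    fun b hb a ha => by
      have := le_pushIter zero_le_one (hw a ha).1 k b hb
      dsimp only [N]
      omega
  refine ⟨B.width (l + k), γ (l + k), N, B.width_pos _, fun b hb => h.generator_pos hb,
    ⟨fun b a => le_max_left 1 _, fun a ha => ?_, fun x hx b hb => ?_⟩, y, hy, hyq.symm⟩
  · rw [← (hw a ha).2, ← h.compatible.eval_pushIter l k, eval_apply]
    exact Finset.sum_congr rfl fun b hb => by
      rw [← hN b (Finset.mem_range.1 hb) a ha, natCast_zsmul]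
  · rw [← hk x ?_ b hb]
    · exact Finset.sum_congr rfl fun a ha => by rw [hN b hb a (Finset.mem_range.1 ha)]
    · rw [← hx]
      exact Finset.sum_congr rfl fun a ha => by rw [(hw a (Finset.mem_range.1 ha)).2]

end Refinement

end BratteliDiagram

/-! ### Splitting off large coprime multiples -/

theorem sum_range_two_mul {M : Type*} [AddCommMonoid M] (f : ℕ → M) (m : ℕ) :
    ∑ e ∈ Finset.range (2 * m), f e = ∑ c ∈ Finset.range m, (f (2 * c) + f (2 * c + 1)) := by
  induction m with
  | zero => simp
  | succ m ih =>
    rw [mul_add, mul_one, Finset.sum_range_succ, Finset.sum_range_succ, ih,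
      Finset.sum_range_succ, add_assoc]

/-- The coefficients of the two parts `2 * c` and `2 * c + 1` into which a generator `c` is split:
the consecutive, hence coprime, numbers `K ^ (c + 1)` and `K ^ (c + 1) + 1`. -/
def splitMult (K e : ℕ) : ℕ := K ^ (e / 2 + 1) + e % 2

theorem splitMult_two_mul (K c : ℕ) : splitMult K (2 * c) = K ^ (c + 1) := by
  simp [splitMult]

theorem splitMult_two_mul_add_one (K c : ℕ) : splitMult K (2 * c + 1) = K ^ (c + 1) + 1 := by
  rw [splitMult, show (2 * c + 1) / 2 = c by omega, show (2 * c + 1) % 2 = 1 by omega]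

theorem le_splitMult (K e : ℕ) : K ≤ splitMult K e :=
  (Nat.le_self_pow (Nat.succ_ne_zero _) K).trans (Nat.le_add_right _ _)

theorem splitMult_mul_lt {K : ℕ} {β : ℕ → ℕ} (hβ : ∀ c, 0 < β c) {e e' : ℕ}
    (hK : 2 * β (e / 2) < K) (hlt : e / 2 < e' / 2) :
    splitMult K e * β (e / 2) < splitMult K e' * β (e' / 2) := by
  have hK1 : 0 < K ^ (e / 2 + 1) := Nat.pow_pos (by omega)
  calc splitMult K e * β (e / 2)
      ≤ (K ^ (e / 2 + 1) + K ^ (e / 2 + 1)) * β (e / 2) :=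
        Nat.mul_le_mul_right _ (Nat.add_le_add_left (by omega) _)
    _ = K ^ (e / 2 + 1) * (2 * β (e / 2)) := by ring
    _ < K ^ (e / 2 + 1) * K := Nat.mul_lt_mul_of_pos_left hK hK1
    _ = K ^ (e / 2 + 1 + 1) := (pow_succ _ _).symm
    _ ≤ K ^ (e' / 2 + 1) := Nat.pow_le_pow_right (by omega) (by omega)
    _ ≤ splitMult K e' := Nat.le_add_right _ _
    _ ≤ splitMult K e' * β (e' / 2) := Nat.le_mul_of_pos_right _ (hβ _)

theorem splitMult_mul_injOn {K s : ℕ} {β : ℕ → ℕ} (hβ : ∀ c, 0 < β c)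
    (hK : ∀ c < s, 2 * β c < K) :
    Set.InjOn (fun e => splitMult K e * β (e / 2)) (Set.Iio (2 * s)) := by
  intro e he e' he' h
  simp only [Set.mem_Iio] at he he'
  rcases lt_trichotomy (e / 2) (e' / 2) with hlt | heq | hlt
  · exact absurd h (splitMult_mul_lt hβ (hK _ (by omega)) hlt).ne
  · simp only [heq] at h
    have := Nat.eq_of_mul_eq_mul_right (hβ _) h
    simp only [splitMult, heq] at this
    omega
  · exact absurd h (splitMult_mul_lt hβ (hK _ (by omega)) hlt).ne'

section Stages

variable {B : BratteliDiagram} {M : Type*} [AddCommGroup M] {γ : ℕ → ℕ → M} {P : Set M}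

theorem BratteliDiagram.Represents.exists_splitMult_smul (h : B.Represents γ P)
    (hB : B.Growing) {s : ℕ} {g : ℕ → M} (hg : ∀ c < s, g c ∈ P ∧ g c ≠ 0) (K : ℕ) :
    ∃ g' : ℕ → M, (∀ e < 2 * s, g' e ∈ P ∧ g' e ≠ 0) ∧ ∀ z : ℕ → ℤ,
      ∑ c ∈ Finset.range s, z c • g c =
        ∑ e ∈ Finset.range (2 * s), (splitMult K e * z (e / 2)) • g' e := by
  choose! g₀ g₁ h₀ h₁ hsplit using fun c (hc : c < s) =>
    h.exists_split hB (hg c hc).1 (hg c hc).2 (p := K ^ (c + 1)) (q := K ^ (c + 1) + 1) (by simp)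
  refine ⟨fun e => if e % 2 = 0 then g₀ (e / 2) else g₁ (e / 2), fun e he => ?_, fun z => ?_⟩
  · dsimp only
    split_ifs
    exacts [h₀ _ (by omega), h₁ _ (by omega)]
  · rw [sum_range_two_mul]
    refine Finset.sum_congr rfl fun c hc => ?_
    dsimp only
    rw [splitMult_two_mul, splitMult_two_mul_add_one, if_pos (by omega), if_neg (by omega),
      show 2 * c / 2 = c by omega, show (2 * c + 1) / 2 = c by omega,
      hsplit c (Finset.mem_range.1 hc), smul_add, mul_comm, mul_smul, mul_comm, mul_smul,
      natCast_zsmul, natCast_zsmul]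

theorem BratteliDiagram.IsRefinement.splitMult_mul {r s : ℕ} {g g' g'' : ℕ → M}
    {N : ℕ → ℕ → ℕ} {K : ℕ} (h : BratteliDiagram.IsRefinement r g s g' N) (hK : 0 < K)
    (hg : ∀ z : ℕ → ℤ, ∑ c ∈ Finset.range s, z c • g' c =
      ∑ e ∈ Finset.range (2 * s), (splitMult K e * z (e / 2)) • g'' e) :
    BratteliDiagram.IsRefinement r g (2 * s) g''
      fun e a => splitMult K e * N (e / 2) a where
  mult_pos e a := Nat.mul_pos (hK.trans_le (le_splitMult K e)) (h.mult_pos _ a)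
  eq_sum a ha := by
    rw [h.eq_sum a ha]
    simpa only [natCast_zsmul, ← Nat.cast_mul] using hg fun c => N c a
  relation x hx e he := by
    simp only [Nat.cast_mul, mul_assoc, ← Finset.mul_sum, h.relation x hx (e / 2) (by omega),
      mul_zero]

end Stages

/-! ### Towers -/

theorem mul_sub_one_mod {k m : ℕ} (hk : 0 < k) (hm : 0 < m) : (k * m - 1) % m = m - 1 := by
  obtain ⟨k, rfl⟩ := Nat.exists_eq_succ_of_ne_zero hk.ne'
  have : k.succ * m - 1 = (m - 1) + k * m := by
    rw [Nat.succ_mul]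
    omega
  rw [this, Nat.add_mul_mod_self_right, Nat.mod_eq_of_lt (by omega)]

theorem sum_range_mul_mod {M : Type*} [AddCommMonoid M] (F : ℕ → M) (k m : ℕ) :
    ∑ s ∈ Finset.range (k * m), F (s % m) = k • ∑ r ∈ Finset.range m, F r := by
  induction k with
  | zero => simp
  | succ k ih =>
    rw [add_mul, one_mul, Finset.sum_range_add, ih, succ_nsmul]
    congr 1
    refine Finset.sum_congr rfl fun r hr => ?_
    rw [Nat.mul_add_mod', Nat.mod_eq_of_lt (Finset.mem_range.1 hr)]

/-- A cutting-and-stacking scheme: the vertex `a` of level `n` is a tower of `height n a` floors,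
and tower `b` of level `n + 1` consists, from bottom to top, of `mult n b 0` copies of tower `0` of
level `n`, then `mult n b 1` copies of tower `1`, and so on. -/
structure TowerData extends BratteliDiagram where
  height : ℕ → ℕ → ℕ
  height_zero_pos : ∀ a, 0 < height 0 a
  height_succ : ∀ n b, height (n + 1) b = ∑ a ∈ Finset.range (width n), mult n b a * height n a

namespace TowerData

variable (B : TowerData)

theorem height_pos : ∀ n a, 0 < B.height n a
  | 0, a => B.height_zero_pos a
  | n + 1, b => by
    rw [B.height_succ]
    exact Finset.sum_pos (fun a _ => Nat.mul_pos (B.mult_pos n b a) (height_pos n a))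
      ⟨0, Finset.mem_range.2 (B.width_pos n)⟩

/-- The floor at which the copies of tower `a` start inside tower `b` of level `n + 1`. -/
def start (n b a : ℕ) : ℕ := ∑ i ∈ Finset.range a, B.mult n b i * B.height n i

/-- The tower of level `n` that contains the floor `j` of tower `b` of level `n + 1`. -/
def towerAt (n b j : ℕ) : ℕ := Nat.findGreatest (fun a => B.start n b a ≤ j) (B.width n - 1)

/-- The address at level `n` of the floor with address `v` at level `n + 1`. An address is a pair
(tower, floor). -/
def descend (n : ℕ) (v : ℕ × ℕ) : ℕ × ℕ :=
  let a := B.towerAt n v.1 v.2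
  (a, (v.2 - B.start n v.1 a) % B.height n a)

/-- `v` is the address of a floor of level `n`. -/
def IsFloor (n : ℕ) (v : ℕ × ℕ) : Prop := v.1 < B.width n ∧ v.2 < B.height n v.1

/-- The floor `w` may follow the floor `v` along an orbit: it is the next floor of the same tower,
if there is one, and any bottom floor otherwise. -/
def Follows (n : ℕ) (v w : ℕ × ℕ) : Prop :=
  (v.2 + 1 < B.height n v.1 → w = (v.1, v.2 + 1)) ∧ (v.2 + 1 = B.height n v.1 → w.2 = 0)

variable {B}

theorem start_zero (n b : ℕ) : B.start n b 0 = 0 := by simp [start]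

theorem start_succ (n b a : ℕ) :
    B.start n b (a + 1) = B.start n b a + B.mult n b a * B.height n a := by
  simp [start, Finset.sum_range_succ]

theorem start_width (n b : ℕ) : B.start n b (B.width n) = B.height (n + 1) b := by
  rw [B.height_succ, start]

theorem start_strictMono (n b : ℕ) : StrictMono (B.start n b) :=
  strictMono_nat_of_lt_succ fun a => by
    rw [start_succ]
    exact Nat.lt_add_of_pos_right (Nat.mul_pos (B.mult_pos n b a) (B.height_pos n a))

theorem towerAt_lt (n b j : ℕ) : B.towerAt n b j < B.width n :=
  (Nat.findGreatest_le _).trans_lt (Nat.sub_lt (B.width_pos n) one_pos)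

theorem start_towerAt_le (n b j : ℕ) : B.start n b (B.towerAt n b j) ≤ j :=
  Nat.findGreatest_spec (P := fun a => B.start n b a ≤ j) (Nat.zero_le _) (by simp [start_zero])

theorem lt_start_towerAt_succ {n b j : ℕ} (hj : j < B.height (n + 1) b) :
    j < B.start n b (B.towerAt n b j + 1) := by
  by_contra! hle
  rcases (Nat.succ_le_of_lt (towerAt_lt (B := B) n b j)).lt_or_eq with hlt | heq
  · have : B.towerAt n b j + 1 ≤ B.towerAt n b j := Nat.le_findGreatest (by omega) hle
    omega
  · rw [← Nat.succ_eq_add_one, heq, start_width] at hle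
    omega

theorem towerAt_eq {n b a j : ℕ} (ha : a < B.width n) (h1 : B.start n b a ≤ j)
    (h2 : j < B.start n b (a + 1)) : B.towerAt n b j = a :=
  le_antisymm (Nat.lt_succ_iff.1 ((start_strictMono n b).lt_iff_lt.1
    ((start_towerAt_le n b j).trans_lt h2))) (Nat.le_findGreatest (by omega) h1)

theorem towerAt_mono (n b : ℕ) : Monotone (B.towerAt n b) := fun _ _ hj =>
  Nat.findGreatest_mono (fun _ h => le_trans h hj) le_rfl

theorem exists_eq_start_add {n b j : ℕ} (hj : j < B.height (n + 1) b) :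
    ∃ a < B.width n, ∃ s < B.mult n b a * B.height n a, j = B.start n b a + s := by
  have h1 := start_towerAt_le (B := B) n b j
  have h2 := lt_start_towerAt_succ hj
  rw [start_succ] at h2
  exact ⟨B.towerAt n b j, towerAt_lt n b j, j - B.start n b (B.towerAt n b j), by omega, by omega⟩

theorem towerAt_start_add {n b a s : ℕ} (ha : a < B.width n)
    (hs : s < B.mult n b a * B.height n a) : B.towerAt n b (B.start n b a + s) = a :=
  towerAt_eq ha (Nat.le_add_right _ _) (by rw [start_succ]; omega)

theorem descend_start_add {n b a s : ℕ} (ha : a < B.width n)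
    (hs : s < B.mult n b a * B.height n a) :
    B.descend n (b, B.start n b a + s) = (a, s % B.height n a) := by
  simp [descend, towerAt_start_add ha hs]

theorem descend_start {n b a : ℕ} (ha : a < B.width n) :
    B.descend n (b, B.start n b a) = (a, 0) := by
  simpa using descend_start_add (b := b) ha (Nat.mul_pos (B.mult_pos n b a) (B.height_pos n a))

theorem descend_zero (n b : ℕ) : B.descend n (b, 0) = (0, 0) := by
  simpa [start_zero] using descend_start (b := b) (B.width_pos n)

theorem descend_top (n b : ℕ) : B.descend n (b, B.height (n + 1) b - 1) =
    (B.width n - 1, B.height n (B.width n - 1) - 1) := by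
  have hwidth := B.width_pos n
  have hpos := Nat.mul_pos (B.mult_pos n b (B.width n - 1)) (B.height_pos n (B.width n - 1))
  have htop : B.height (n + 1) b - 1 = B.start n b (B.width n - 1) +
      (B.mult n b (B.width n - 1) * B.height n (B.width n - 1) - 1) := by
    rw [← start_width, ← Nat.sub_add_cancel hwidth, start_succ, Nat.add_sub_assoc hpos]
    simp
  rw [htop, descend_start_add (by omega) (by omega),
    mul_sub_one_mod (B.mult_pos _ _ _) (B.height_pos _ _)]

theorem isFloor_descend (n : ℕ) (v : ℕ × ℕ) : B.IsFloor n (B.descend n v) :=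
  ⟨towerAt_lt _ _ _, Nat.mod_lt _ (B.height_pos _ _)⟩

theorem descend_succ {n b j : ℕ} (hj : j + 1 < B.height (n + 1) b) :
    (B.towerAt n b (j + 1) = B.towerAt n b j ∧
      B.Follows n (B.descend n (b, j)) (B.descend n (b, j + 1))) ∨
    (B.towerAt n b (j + 1) = B.towerAt n b j + 1 ∧
      (B.descend n (b, j)).2 + 1 = B.height n (B.towerAt n b j) ∧
      j + 1 = B.start n b (B.towerAt n b (j + 1)) ∧ (B.descend n (b, j + 1)).2 = 0) := by
  obtain ⟨a, ha, s, hs, rfl⟩ := exists_eq_start_add (Nat.lt_of_succ_lt hj)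
  rw [towerAt_start_add ha hs, descend_start_add ha hs]
  rcases (show s + 1 ≤ _ from hs).lt_or_eq with hlt | hs'
  · left
    rw [add_assoc, towerAt_start_add ha hlt, descend_start_add ha hlt]
    refine ⟨rfl, fun h1 => ?_, fun h1 => ?_⟩
    · dsimp only at h1 ⊢
      rw [← Nat.mod_add_mod, Nat.mod_eq_of_lt h1]
    · dsimp only at h1 ⊢
      rw [← Nat.mod_add_mod, h1, Nat.mod_self]
  · right
    have hstart : B.start n b a + s + 1 = B.start n b (a + 1) := by
      rw [start_succ, ← hs', add_assoc]
    have ha' : a + 1 < B.width n := (start_strictMono n b).lt_iff_lt.1 (by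
      rwa [← hstart, start_width])
    have htower := towerAt_start_add (b := b) ha'
      (Nat.mul_pos (B.mult_pos n b (a + 1)) (B.height_pos n (a + 1)))
    rw [add_zero] at htower
    rw [hstart, htower, descend_start ha']
    have hmod := mul_sub_one_mod (B.mult_pos n b a) (B.height_pos n a)
    rw [← hs', Nat.add_sub_cancel] at hmod
    exact ⟨rfl, by rw [hmod, Nat.sub_add_cancel (B.height_pos n a)], rfl, rfl⟩

theorem Follows.eq_of_snd_ne_zero {n : ℕ} {v w : ℕ × ℕ} (h : B.Follows n v w) (hv : B.IsFloor n v)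
    (hw : w.2 ≠ 0) : w = (v.1, v.2 + 1) :=
  h.1 ((Nat.succ_le_of_lt hv.2).lt_of_ne fun heq => hw (h.2 heq))

theorem follows_descend {n b j : ℕ} (hj : j + 1 < B.height (n + 1) b) :
    B.Follows n (B.descend n (b, j)) (B.descend n (b, j + 1)) := by
  rcases descend_succ hj with ⟨-, h⟩ | ⟨-, h1, -, h2⟩
  · exact h
  · exact ⟨fun h => absurd h1 h.ne, fun _ => h2⟩

theorem sum_descend {M : Type*} [AddCommMonoid M] (F : ℕ × ℕ → M) (n b : ℕ) :
    ∑ j ∈ Finset.range (B.height (n + 1) b), F (B.descend n (b, j)) =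
      ∑ a ∈ Finset.range (B.width n),
        B.mult n b a • ∑ r ∈ Finset.range (B.height n a), F (a, r) := by
  have sum_below : ∀ a ≤ B.width n,
      ∑ j ∈ Finset.range (B.start n b a), F (B.descend n (b, j)) =
        ∑ i ∈ Finset.range a, B.mult n b i • ∑ r ∈ Finset.range (B.height n i), F (i, r) := by
    intro a
    induction a with
    | zero => simp [start_zero]
    | succ a ih =>
      intro ha
      rw [start_succ, Finset.sum_range_add, ih (by omega), Finset.sum_range_succ,
        ← sum_range_mul_mod (fun r => F (a, r))]
      congr 1
      exact Finset.sum_congr rfl fun s hs => by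
        rw [descend_start_add (by omega) (Finset.mem_range.1 hs)]
  rw [← start_width]
  exact sum_below _ le_rfl

end TowerData

/-- The positive cone of an ordered group, as a submonoid. -/
def IsOrderedGroup.addSubmonoid {G : Type*} [AddCommGroup G] {Gp : Set G}
    (hG : IsOrderedGroup Gp) : AddSubmonoid G where
  carrier := Gp
  zero_mem' := ((hG.mem_and_neg_mem 0).2 rfl).1
  add_mem' ha hb := hG.add_mem _ ha _ hb

theorem IsOrderedGroup.sum_zsmul_mem {G : Type*} [AddCommGroup G] {Gp : Set G}
    (hG : IsOrderedGroup Gp) {s : Finset ℕ} {x : ℕ → ℤ} {g : ℕ → G} (hx : ∀ a ∈ s, 0 ≤ x a)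
    (hg : ∀ a ∈ s, g a ∈ Gp) : ∑ a ∈ s, x a • g a ∈ Gp :=
  hG.addSubmonoid.sum_mem fun a ha => by
    obtain ⟨k, hk⟩ := Int.eq_ofNat_of_zero_le (hx a ha)
    rw [hk, natCast_zsmul]
    exact hG.addSubmonoid.nsmul_mem (hg a ha) k

/-- Each level of the scheme has at least two towers, and no two towers of a level are stacked in
the same way. The itineraries of such a scheme can be read off their lowest levels. -/
structure TowerData.Separating (B : TowerData) : Prop where
  two_le_width : ∀ n, 2 ≤ B.width n
  row_inj : ∀ n, ∀ b < B.width (n + 1), ∀ b' < B.width (n + 1),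
    (∀ a < B.width n, B.mult n b a = B.mult n b' a) → b = b'

/-- One level of a cutting-and-stacking scheme, with positive elements of the group that are to
become the classes of the bottom floors. -/
structure Stage {M : Type*} [AddCommGroup M] (P : Set M) where
  width : ℕ
  gen : ℕ → M
  height : ℕ → ℕ
  two_le_width : 2 ≤ width
  gen_pos : ∀ a < width, gen a ∈ P ∧ gen a ≠ 0

/-- The towers of `s'` are stacked from those of `s` according to `N`. -/
structure Stage.Refines {M : Type*} [AddCommGroup M] {P : Set M} (s s' : Stage P)
    (N : ℕ → ℕ → ℕ) : Prop where
  isRefinement : BratteliDiagram.IsRefinement s.width s.gen s'.width s'.gen N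
  height_eq : ∀ b, s'.height b = ∑ a ∈ Finset.range s.width, N b a * s.height a
  row_inj : ∀ b < s'.width, ∀ b' < s'.width, (∀ a < s.width, N b a = N b' a) → b = b'

namespace BratteliDiagram.Represents

variable {B : BratteliDiagram} {M : Type*} [AddCommGroup M] {γ : ℕ → ℕ → M} {P : Set M}

theorem exists_refines (h : B.Represents γ P) (hB : B.Growing) (s : Stage P) (q : M) (Φ : ℕ → ℕ) :
    ∃ s' N, s.Refines s' N ∧ (∀ b a, Φ s'.width ≤ N b a) ∧ ∃ y : ℕ → ℤ,
      (q ∈ P → ∀ b < s'.width, 0 ≤ y b) ∧ q = ∑ b ∈ Finset.range s'.width, y b • s'.gen b := by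
  obtain ⟨m, g, N, hm, hg, hN, y, hy, hyq⟩ := h.exists_isRefinement s.gen_pos q
  let K := Φ (2 * m) + 2 * (∑ c ∈ Finset.range m, N c 0) + 1
  have two_mul_lt : ∀ c < m, 2 * N c 0 < K := fun c hc => by
    have := Finset.single_le_sum (f := fun c => N c 0) (fun _ _ => Nat.zero_le _)
      (Finset.mem_range.2 hc)
    omega
  obtain ⟨g', hg', hsplit⟩ := h.exists_splitMult_smul hB hg K
  let N' : ℕ → ℕ → ℕ := fun e a => splitMult K e * N (e / 2) a
  refine ⟨⟨2 * m, g', fun e => ∑ a ∈ Finset.range s.width, N' e a * s.height a, by omega, hg'⟩, N',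
    ⟨hN.splitMult_mul (by omega) hsplit, fun _ => rfl, fun e he e' he' hrow => ?_⟩, fun e a => ?_,
    fun e => splitMult K e * y (e / 2), fun hq e he => ?_, hyq.trans (hsplit y)⟩
  · exact splitMult_mul_injOn (fun c => hN.mult_pos c 0) two_mul_lt he he'
      (hrow 0 (two_pos.trans_le s.two_le_width))
  · calc Φ (2 * m) ≤ K := by omega
      _ ≤ splitMult K e := le_splitMult K e
      _ ≤ N' e a := Nat.le_mul_of_pos_right _ (hN.mult_pos _ a)
  · dsimp only at he
    exact mul_nonneg (by positivity) (hy hq (e / 2) (by omega))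

theorem exists_towerData (h : B.Represents γ P) (hB : B.Growing) (hP : IsOrderedGroup P) {u : M}
    (hu : u ∈ P) (hu0 : u ≠ 0) (Φ : ℕ → ℕ → (ℕ → ℕ) → ℕ → ℕ) :
    ∃ (B' : TowerData) (γ' : ℕ → ℕ → M), B'.Separating ∧ B'.Represents γ' P ∧
      u = B'.eval γ' 0 (fun a => B'.height 0 a) ∧
      ∀ n b a, Φ n (B'.width n) (B'.height n) (B'.width (n + 1)) ≤ B'.mult n b a := by
  have := hP.countable
  obtain ⟨q, hq⟩ := exists_surjective_nat M
  obtain ⟨g₀, g₁, hg₀, hg₁, hsplit⟩ := h.exists_split hB hu hu0 (p := 1) (q := 1) (by simp)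
  let s₀ : Stage P :=
    { width := 2
      gen := fun a => if a = 0 then g₀ else g₁
      height := fun _ => 1
      two_le_width := le_rfl
      gen_pos := fun a _ => by split_ifs <;> assumption }
  choose next N hN hΦ y hy hyq using fun (n : ℕ) (s : Stage P) =>
    h.exists_refines hB s (q n) (Φ n s.width s.height)
  let s : ℕ → Stage P := fun n => Nat.rec s₀ next n
  have hs : ∀ n, (s n).Refines (s (n + 1)) (N n (s n)) := fun n => hN n (s n)
  refine ⟨⟨⟨fun n => (s n).width, fun n => N n (s n),
      fun n => two_pos.trans_le (s n).two_le_width, fun n => (hs n).isRefinement.mult_pos⟩,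
      fun n => (s n).height, fun _ => one_pos, fun n => (hs n).height_eq⟩, fun n => (s n).gen,
    ⟨fun n => (s n).two_le_width, fun n => (hs n).row_inj⟩,
    ⟨fun n => (hs n).isRefinement.eq_sum, fun g => ?_, fun g => ⟨fun hg => ?_, ?_⟩,
      fun n x hx => ⟨1, (hs n).isRefinement.relation x hx⟩⟩, ?_, fun n => hΦ n (s n)⟩
  · obtain ⟨n, rfl⟩ := hq g
    exact ⟨n + 1, y n (s n), (hyq n (s n)).symm⟩
  · obtain ⟨n, rfl⟩ := hq g
    exact ⟨n + 1, y n (s n), hy n (s n) hg, (hyq n (s n)).symm⟩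
  · rintro ⟨n, x, hx, rfl⟩
    exact hP.sum_zsmul_mem (fun a ha => hx a (Finset.mem_range.1 ha))
      fun a ha => ((s n).gen_pos a (Finset.mem_range.1 ha)).1
  · change u = ∑ a ∈ Finset.range 2, (1 : ℤ) • (if a = 0 then g₀ else g₁)
    simpa [Finset.sum_range_succ] using hsplit

end BratteliDiagram.Represents

/-! ### Systems partitioned into towers -/

/-- A homeomorphism `T` of a space that is partitioned, for each `n`, into the floors of the towers
of level `n` of `B`, with `T` going up the towers. Each continuous integer function is constant on
the floors, and on the union of the bottom floors, of all large enough levels. -/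
structure TowerSystem (B : TowerData) {X : Type*} [TopologicalSpace X] (T : X ≃ₜ X) where
  addr : ℕ → X → ℕ × ℕ
  continuous_addr : ∀ n, Continuous (addr n)
  isFloor : ∀ n x, B.IsFloor n (addr n x)
  follows : ∀ n x, B.Follows n (addr n x) (addr n (T x))
  descend_addr : ∀ n x, B.descend n (addr (n + 1) x) = addr n x
  separates : ∀ f : C(X, ℤ), ∃ N, ∀ n ≥ N, ∀ x x',
    (addr n x = addr n x' ∨ ((addr n x).2 = 0 ∧ (addr n x').2 = 0)) → f x = f x'

namespace TowerSystem

open TowerData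

variable {B : TowerData} {X : Type*} [TopologicalSpace X] {T : X ≃ₜ X} (S : TowerSystem B T)

theorem addr_iterate {n b j : ℕ} {x : X} (hx : S.addr n x = (b, j)) :
    ∀ k, j + k < B.height n b → S.addr n (T^[k] x) = (b, j + k)
  | 0, _ => hx
  | k + 1, hk => by
    have ih := addr_iterate hx k (by omega)
    rw [Function.iterate_succ_apply', (S.follows n (T^[k] x)).1 (by rw [ih]; exact hk), ih]
    rfl

theorem addr_iterate_top {n b j k : ℕ} {x : X} (hx : S.addr n x = (b, j))
    (hk : j + k + 1 = B.height n b) : (S.addr n (T^[k + 1] x)).2 = 0 := by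
  rw [Function.iterate_succ_apply']
  exact (S.follows n _).2 (by rw [S.addr_iterate hx k (by omega)]; exact hk)

theorem exists_iterate_bottom (n : ℕ) (x : X) : ∃ k, (S.addr n (T^[k] x)).2 = 0 := by
  have hfloor := (S.isFloor n x).2
  obtain ⟨k, hk⟩ := Nat.exists_eq_add_of_lt hfloor
  exact ⟨k + 1, S.addr_iterate_top (k := k) rfl hk.symm⟩

theorem exists_iterate_addr {n : ℕ} {v : ℕ × ℕ} (hv : B.IsFloor n v) (x : X) :
    ∃ k, S.addr n (T^[k] x) = v := by
  obtain ⟨a, r⟩ := v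
  obtain ⟨ha, hr⟩ : a < B.width n ∧ r < B.height n a := hv
  obtain ⟨k, hk⟩ := S.exists_iterate_bottom (n + 1) x
  obtain ⟨c, hc⟩ : ∃ c, S.addr (n + 1) (T^[k] x) = (c, 0) := ⟨_, Prod.ext rfl hk⟩
  have hrmul : r < B.mult n c a * B.height n a :=
    hr.trans_le (Nat.le_mul_of_pos_left _ (B.mult_pos n c a))
  have hlt : B.start n c a + r < B.height (n + 1) c := by
    have := (start_strictMono (B := B) n c).monotone (Nat.succ_le_of_lt ha)
    rw [Nat.succ_eq_add_one, start_succ, start_width] at this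
    omega
  refine ⟨B.start n c a + r + k, ?_⟩
  rw [Function.iterate_add_apply, ← S.descend_addr, S.addr_iterate hc _ (by omega), zero_add,
    descend_start_add ha hrmul, Nat.mod_eq_of_lt hr]

theorem isMinimalSystem (S : TowerSystem B T) [CompactSpace X] [T2Space X]
    [TotallyDisconnectedSpace X] [Nonempty X] : IsMinimalSystem T := by
  refine ⟨inferInstance, fun C hC hT => or_iff_not_imp_left.2 fun hne => ?_⟩
  obtain ⟨y, hy⟩ := Set.nonempty_iff_ne_empty.2 hne
  by_contra hC'
  obtain ⟨x, hx⟩ := (Set.ne_univ_iff_exists_notMem C).1 hC'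
  obtain ⟨U, hU, hxU, hUC⟩ := compact_exists_isClopen_in_isOpen hC.isOpen_compl hx
  obtain ⟨N, hN⟩ := S.separates (LocallyConstant.charFn ℤ hU : C(X, ℤ))
  obtain ⟨k, hk⟩ := S.exists_iterate_addr (S.isFloor N x) y
  have hmem : T^[k] y ∈ U := by
    have := hN N le_rfl _ _ (Or.inl hk)
    simpa [LocallyConstant.charFn, Set.indicator, hxU] using this
  exact hUC hmem (hT.iterate k hy)

/-- The indicator function of the floor with address `v` at level `n`. -/
def floorFn (n : ℕ) (v : ℕ × ℕ) : C(X, ℤ) :=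
  ⟨fun x => if S.addr n x = v then 1 else 0,
    (continuous_of_discreteTopology (f := fun w : ℕ × ℕ => if w = v then (1 : ℤ) else 0)).comp
      (S.continuous_addr n)⟩

theorem floorFn_apply (n : ℕ) (v : ℕ × ℕ) (x : X) :
    S.floorFn n v x = if S.addr n x = v then 1 else 0 := rfl

/-- The class in `K0` of the bottom floor of tower `a` of level `n`. -/
def baseClass (n a : ℕ) : K0 T := QuotientAddGroup.mk (S.floorFn n (a, 0))

theorem addr_apply_eq_succ_iff {n b j : ℕ} (hj : j + 1 < B.height n b) (x : X) :
    S.addr n (T x) = (b, j + 1) ↔ S.addr n x = (b, j) := by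
  constructor
  · intro h
    have := (S.follows n x).eq_of_snd_ne_zero (S.isFloor n x) (by simp [h])
    simp only [h, Prod.mk.injEq, Nat.add_right_cancel_iff] at this
    exact Prod.ext this.1.symm this.2.symm
  · intro h
    rw [(S.follows n x).1 (by rw [h]; exact hj), h]

theorem mk_floorFn (n b : ℕ) :
    ∀ j < B.height n b, (QuotientAddGroup.mk (S.floorFn n (b, j)) : K0 T) = S.baseClass n b
  | 0, _ => rfl
  | j + 1, hj => by
    rw [← mk_floorFn n b j (by omega), eq_comm, ← sub_eq_zero, ← QuotientAddGroup.mk_sub,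
      QuotientAddGroup.eq_zero_iff]
    refine ⟨S.floorFn n (b, j + 1), ?_⟩
    ext x
    simp [coboundary, floorFn_apply, S.addr_apply_eq_succ_iff hj]

theorem eq_sum_floorFn {n : ℕ} {f : C(X, ℤ)} {F : ℕ × ℕ → ℤ} (hF : ∀ x, f x = F (S.addr n x)) :
    f = ∑ b ∈ Finset.range (B.width n), ∑ j ∈ Finset.range (B.height n b),
      F (b, j) • S.floorFn n (b, j) := by
  ext x
  obtain ⟨hb, hj⟩ := S.isFloor n x
  simp only [ContinuousMap.coe_sum, Finset.sum_apply, ContinuousMap.coe_smul, Pi.smul_apply,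
    floorFn_apply]
  rw [Finset.sum_eq_single_of_mem _ (Finset.mem_range.2 hb) fun b _ hne => Finset.sum_eq_zero
      fun j _ => by simp [Prod.ext_iff, hne.symm],
    Finset.sum_eq_single_of_mem _ (Finset.mem_range.2 hj) fun j _ hne => by
      simp [Prod.ext_iff, hne.symm]]
  simp [hF]

theorem mk_eq_eval {n : ℕ} {f : C(X, ℤ)} {F : ℕ × ℕ → ℤ} (hF : ∀ x, f x = F (S.addr n x)) :
    (QuotientAddGroup.mk f : K0 T) =
      B.eval S.baseClass n fun b => ∑ j ∈ Finset.range (B.height n b), F (b, j) := by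
  change QuotientAddGroup.mk' (coboundary T).range f = _
  rw [S.eq_sum_floorFn hF, map_sum, BratteliDiagram.eval_apply]
  refine Finset.sum_congr rfl fun b _ => ?_
  rw [map_sum]
  refine Eq.trans ?_ (Finset.sum_smul (f := fun j => F (b, j)) (x := S.baseClass n b)).symm
  refine Finset.sum_congr rfl fun j hj => ?_
  rw [map_zsmul]
  exact congrArg _ (S.mk_floorFn n b j (Finset.mem_range.1 hj))

theorem unit_eq_eval : K0.unit T = B.eval S.baseClass 0 fun a => B.height 0 a := by
  rw [K0.unit, S.mk_eq_eval (n := 0) (F := fun _ => 1) fun _ => rfl]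
  simp

/-- The function with the value `y a` on the bottom floor of tower `a` and `0` on other floors. -/
def baseFn (n : ℕ) (y : ℕ → ℤ) : C(X, ℤ) :=
  ∑ a ∈ Finset.range (B.width n), y a • S.floorFn n (a, 0)

theorem baseFn_apply (n : ℕ) (y : ℕ → ℤ) (x : X) :
    S.baseFn n y x = if (S.addr n x).2 = 0 then y (S.addr n x).1 else 0 := by
  simp only [baseFn, ContinuousMap.coe_sum, Finset.sum_apply, ContinuousMap.coe_smul, Pi.smul_apply,
    floorFn_apply]
  rw [Finset.sum_eq_single_of_mem _ (Finset.mem_range.2 (S.isFloor n x).1) fun b _ hne => by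
    simp [Prod.ext_iff, hne.symm]]
  simp [Prod.ext_iff]

theorem mk_baseFn (n : ℕ) (y : ℕ → ℤ) :
    (QuotientAddGroup.mk (S.baseFn n y) : K0 T) = B.eval S.baseClass n y := by
  change QuotientAddGroup.mk' (coboundary T).range _ = _
  rw [baseFn, map_sum, BratteliDiagram.eval_apply]
  exact Finset.sum_congr rfl fun a _ => map_zsmul _ _ _

theorem exists_baseFn_eq_comp_addr (n k : ℕ) (y : ℕ → ℤ) : ∃ F : ℕ × ℕ → ℤ,
    (∀ x, S.baseFn n y x = F (S.addr (n + k) x)) ∧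
      ∀ b, ∑ j ∈ Finset.range (B.height (n + k) b), F (b, j) = B.pushIter n k y b := by
  induction k with
  | zero =>
    refine ⟨fun v => if v.2 = 0 then y v.1 else 0, S.baseFn_apply n y, fun b => ?_⟩
    simp [BratteliDiagram.pushIter, B.height_pos n b]
  | succ k ih =>
    obtain ⟨F, hF, hsum⟩ := ih
    refine ⟨fun v => F (B.descend (n + k) v), fun x => by rw [hF, ← S.descend_addr]; rfl,
      fun b => ?_⟩
    rw [← add_assoc, sum_descend, BratteliDiagram.pushIter_succ, BratteliDiagram.push_apply]
    simp [hsum]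

theorem compatible_baseClass : B.Compatible S.baseClass := fun n a ha => by
  obtain ⟨F, hF, hsum⟩ := S.exists_baseFn_eq_comp_addr n 1 (Pi.single a 1)
  have hbase : B.eval S.baseClass n (Pi.single a 1) = S.baseClass n a := by
    simp [BratteliDiagram.eval_apply, Pi.single_apply, ite_smul, ha]
  rw [← hbase, ← mk_baseFn, S.mk_eq_eval hF, BratteliDiagram.eval_apply]
  refine Finset.sum_congr rfl fun b _ => ?_
  rw [hsum]
  simp [BratteliDiagram.pushIter, BratteliDiagram.push_apply, Pi.single_apply, ha]

theorem sum_coboundary_iterate (f : C(X, ℤ)) (x : X) (k : ℕ) :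
    ∑ j ∈ Finset.range k, coboundary T f (T^[j] x) = f (T^[k] x) - f x := by
  refine Eq.trans ?_ (Finset.sum_range_sub (fun j => f (T^[j] x)) k)
  simp [coboundary, Function.iterate_succ_apply']

theorem exists_eq_comp_addr (f : C(X, ℤ)) :
    ∃ n, ∃ F : ℕ × ℕ → ℤ, (∀ x, f x = F (S.addr n x)) ∧ ((∀ x, 0 ≤ f x) → ∀ v, 0 ≤ F v) := by
  obtain ⟨n, hn⟩ := S.separates f
  refine ⟨n, Function.extend (S.addr n) f 0, fun x => ?_, fun hf v => ?_⟩
  · have factors : Function.FactorsThrough f (S.addr n) := fun _ _ h => hn n le_rfl _ _ (Or.inl h)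
    exact (factors.extend_apply 0 x).symm
  · classical
    rw [Function.extend_def]
    split_ifs
    exacts [hf _, le_rfl]

/-- The sum of a coboundary along a tower of a high level vanishes, since the transfer function
takes the same value at all bottom floors. -/
theorem exists_pushIter_eq_zero [Nonempty X] {n : ℕ} {y : ℕ → ℤ}
    (hy : B.eval S.baseClass n y = 0) :
    ∃ k, ∀ b < B.width (n + k), B.pushIter n k y b = 0 := by
  rw [← mk_baseFn] at hy
  obtain ⟨f, hf⟩ := (QuotientAddGroup.eq_zero_iff _).1 hy
  obtain ⟨k, hk⟩ := S.separates f
  obtain ⟨F, hF, hsum⟩ := S.exists_baseFn_eq_comp_addr n k y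
  refine ⟨k, fun b hb => ?_⟩
  obtain ⟨x₀⟩ := ‹Nonempty X›
  obtain ⟨i, hi⟩ := S.exists_iterate_addr (v := (b, 0)) ⟨hb, B.height_pos (n + k) b⟩ x₀
  set x := T^[i] x₀
  have hheight := B.height_pos (n + k) b
  have htop := S.addr_iterate_top (k := B.height (n + k) b - 1) hi (by omega)
  rw [Nat.sub_add_cancel hheight] at htop
  calc B.pushIter n k y b
      = ∑ j ∈ Finset.range (B.height (n + k) b), coboundary T f (T^[j] x) := by
        rw [← hsum, hf]
        refine Finset.sum_congr rfl fun j hj => ?_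
        rw [hF, S.addr_iterate hi j (by simpa using hj), zero_add]
    _ = f (T^[B.height (n + k) b] x) - f x := sum_coboundary_iterate f x _
    _ = 0 := sub_eq_zero.2 (hk _ (Nat.le_add_left k n) _ _ (Or.inr ⟨htop, by rw [hi]⟩))

theorem represents [Nonempty X] : B.Represents S.baseClass (K0.pos T) where
  compatible := S.compatible_baseClass
  exists_eval_eq g := by
    obtain ⟨f, rfl⟩ := QuotientAddGroup.mk_surjective g
    obtain ⟨n, F, hF, -⟩ := S.exists_eq_comp_addr f
    exact ⟨n, _, (S.mk_eq_eval hF).symm⟩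
  mem_iff g := by
    constructor
    · rintro ⟨f, hf, rfl⟩
      obtain ⟨n, F, hF, hF0⟩ := S.exists_eq_comp_addr f
      exact ⟨n, _, fun a _ => Finset.sum_nonneg fun j _ => hF0 hf _, (S.mk_eq_eval hF).symm⟩
    · rintro ⟨n, y, hy, rfl⟩
      refine ⟨S.baseFn n y, fun x => ?_, S.mk_baseFn n y⟩
      rw [baseFn_apply]
      split_ifs
      exacts [hy _ (S.isFloor n x).1, le_rfl]
  eventually_zero _ _ hy := S.exists_pushIter_eq_zero hy

theorem orderedUnitIso (S : TowerSystem B T) [Nonempty X] {G : Type*} [AddCommGroup G]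
    {γ : ℕ → ℕ → G} {Gp : Set G} (h : B.Represents γ Gp) :
    OrderedUnitIso (K0.pos T) (K0.unit T) Gp (B.eval γ 0 fun a => B.height 0 a) := by
  obtain ⟨φ, hpos, heval⟩ := S.represents.exists_addEquiv h
  exact ⟨φ, hpos, by rw [S.unit_eq_eval, heval]⟩

end TowerSystem

/-! ### Itineraries -/

namespace TowerData

/-- `t n i` is the address at level `n` of the point of an orbit at time `i`, for some (possibly
ideal) orbit that climbs the towers of all levels. -/
structure IsItinerary (B : TowerData) (t : ℕ → ℤ → ℕ × ℕ) : Prop where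
  isFloor : ∀ n i, B.IsFloor n (t n i)
  follows : ∀ n i, B.Follows n (t n i) (t n (i + 1))
  descend : ∀ n i, B.descend n (t (n + 1) i) = t n i

variable {B : TowerData}

theorem follows_descend_of_follows {n : ℕ} {v w : ℕ × ℕ} (hv : B.IsFloor (n + 1) v)
    (h : B.Follows (n + 1) v w) : B.Follows n (B.descend n v) (B.descend n w) := by
  obtain ⟨b, j⟩ := v
  rcases (show j + 1 ≤ _ from hv.2).lt_or_eq with hlt | heq
  · rw [h.1 hlt]
    exact follows_descend hlt
  · obtain ⟨c, k⟩ := w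
    obtain rfl : k = 0 := h.2 heq
    obtain rfl : j = B.height (n + 1) b - 1 := Nat.eq_sub_of_add_eq heq
    have hheight := B.height_pos n (B.width n - 1)
    rw [descend_zero, descend_top]
    exact ⟨fun h1 => absurd h1 (by simp only; omega), fun _ => rfl⟩

namespace IsItinerary

variable {t t' : ℕ → ℤ → ℕ × ℕ}

theorem shift (ht : B.IsItinerary t) (k : ℤ) : B.IsItinerary fun n i => t n (k + i) where
  isFloor n i := ht.isFloor n _
  follows n i := by simpa only [add_assoc] using ht.follows n (k + i)
  descend n i := ht.descend n _

theorem eq_of_le (ht : B.IsItinerary t) (ht' : B.IsItinerary t') {n m : ℕ} (hmn : m ≤ n) {i : ℤ}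
    (h : t n i = t' n i) : t m i = t' m i := by
  induction n, hmn using Nat.le_induction with
  | base => exact h
  | succ n _ ih => exact ih (by rw [← ht.descend, ← ht'.descend, h])

theorem follows_pred (ht : B.IsItinerary t) (n : ℕ) (i : ℤ) :
    B.Follows n (t n (i - 1)) (t n i) := by
  simpa using ht.follows n (i - 1)

theorem add (ht : B.IsItinerary t) {n b j : ℕ} {i : ℤ} (hi : t n i = (b, j)) :
    ∀ k : ℕ, j + k < B.height n b → t n (i + k) = (b, j + k)
  | 0, _ => by simpa using hi
  | k + 1, hk => by
    have ih := ht.add hi k (by omega)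
    have hnext := (ht.follows n (i + k)).1 (by rw [ih]; exact hk)
    rw [ih, add_assoc] at hnext
    exact_mod_cast hnext

theorem pred (ht : B.IsItinerary t) {n b j : ℕ} {i : ℤ} (hi : t n i = (b, j + 1)) :
    t n (i - 1) = (b, j) := by
  have := (ht.follows_pred n i).eq_of_snd_ne_zero (ht.isFloor n _) (by simp [hi])
  simp only [hi, Prod.mk.injEq, Nat.add_right_cancel_iff] at this
  exact Prod.ext this.1.symm this.2.symm

theorem sub (ht : B.IsItinerary t) {n b j : ℕ} {i : ℤ} :
    ∀ {k : ℕ}, t n i = (b, j + k) → t n (i - k) = (b, j)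
  | 0, hi => by simpa using hi
  | k + 1, hi => by
    have ih := ht.sub (ht.pred hi)
    rw [sub_sub, add_comm (1 : ℤ)] at ih
    exact_mod_cast ih

theorem top_pred_of_bottom (ht : B.IsItinerary t) {n : ℕ} {i : ℤ} (hi : (t n i).2 = 0) :
    (t n (i - 1)).2 + 1 = B.height n (t n (i - 1)).1 := by
  refine (Nat.succ_le_of_lt (ht.isFloor n (i - 1)).2).eq_or_lt.resolve_right fun hlt => ?_
  simp [(ht.follows_pred n i).1 hlt] at hi

theorem add_of_bottom (ht : B.IsItinerary t) {n : ℕ} {i : ℤ} (hi : (t (n + 1) i).2 = 0) {k : ℕ}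
    (hk : k < B.height n 0) : t n (i + k) = (0, k) := by
  have hstart : t n i = (0, 0) := by
    rw [← ht.descend, ← Prod.mk.eta (p := t (n + 1) i), hi, descend_zero]
  simpa using ht.add hstart k (by simpa using hk)

theorem sub_of_bottom (ht : B.IsItinerary t) {n : ℕ} {i : ℤ} (hi : (t (n + 1) i).2 = 0) {k : ℕ}
    (hk : k < B.height n (B.width n - 1)) :
    t n (i - 1 - k) = (B.width n - 1, B.height n (B.width n - 1) - 1 - k) := by
  refine ht.sub ?_
  rw [Nat.sub_add_cancel (by omega), ← descend_top n (t (n + 1) (i - 1)).1, ← ht.descend]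
  exact congrArg _ (Prod.ext rfl (Nat.eq_sub_of_add_eq (ht.top_pred_of_bottom hi)))

theorem eq_add (ht : B.IsItinerary t) (ht' : B.IsItinerary t') {n : ℕ} {k : ℕ}
    (hk : k < B.height n 0) : ∀ {i : ℤ},
    (t (n + 1) i = t' (n + 1) i ∨ ((t (n + 1) i).2 = 0 ∧ (t' (n + 1) i).2 = 0)) →
      t n (i + k) = t' n (i + k) := by
  induction k with
  | zero =>
    rintro i (h | ⟨h, h'⟩)
    · simpa using ht.eq_of_le ht' n.le_succ h
    · rw [ht.add_of_bottom h hk, ht'.add_of_bottom h' hk]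
  | succ k ih =>
    rintro i (h | ⟨h, h'⟩)
    · have hnext := ht.follows (n + 1) i
      have hnext' := h ▸ ht'.follows (n + 1) i
      rw [show i + (k + 1 : ℕ) = i + 1 + k by push_cast; ring]
      refine ih (by omega) ?_
      rcases (Nat.succ_le_of_lt (ht.isFloor (n + 1) i).2).lt_or_eq with hlt | heq
      · exact Or.inl ((hnext.1 hlt).trans (hnext'.1 hlt).symm)
      · exact Or.inr ⟨hnext.2 heq, hnext'.2 heq⟩
    · rw [ht.add_of_bottom h hk, ht'.add_of_bottom h' hk]

theorem eq_sub (ht : B.IsItinerary t) (ht' : B.IsItinerary t') {n : ℕ} {k : ℕ}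
    (hk : k ≤ B.height n (B.width n - 1)) : ∀ {i : ℤ},
    (t (n + 1) i = t' (n + 1) i ∨ ((t (n + 1) i).2 = 0 ∧ (t' (n + 1) i).2 = 0)) →
      t n (i - k) = t' n (i - k) := by
  induction k with
  | zero =>
    intro i h
    simpa using ht.eq_add ht' (B.height_pos n 0) h
  | succ k ih =>
    intro i h
    rw [show i - (k + 1 : ℕ) = i - 1 - k by push_cast; ring]
    by_cases hbottom : (t (n + 1) i).2 = 0 ∧ (t' (n + 1) i).2 = 0
    · rw [ht.sub_of_bottom hbottom.1 hk, ht'.sub_of_bottom hbottom.2 hk]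
    · have h := h.resolve_right hbottom
      rw [h, and_self] at hbottom
      obtain ⟨b, j, hbj⟩ : ∃ b j, t' (n + 1) i = (b, j + 1) :=
        ⟨_, _, Prod.ext rfl (Nat.succ_pred_eq_of_ne_zero hbottom).symm⟩
      exact ih (by omega) (Or.inl ((ht.pred (h.trans hbj)).trans (ht'.pred hbj).symm))

theorem eq_of_abs_le (ht : B.IsItinerary t) (ht' : B.IsItinerary t') {n K : ℕ}
    (h : t (n + 1) 0 = t' (n + 1) 0 ∨ ((t (n + 1) 0).2 = 0 ∧ (t' (n + 1) 0).2 = 0))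
    (hK : ∀ a, K < B.height n a) {i : ℤ} (hi : |i| ≤ K) : t n i = t' n i := by
  rw [Int.abs_eq_natAbs] at hi
  rcases Int.natAbs_eq i with h' | h' <;> rw [h']
  · simpa using ht.eq_add ht' (k := i.natAbs) ((by omega : i.natAbs ≤ K).trans_lt (hK 0)) h
  · simpa using ht.eq_sub ht' (k := i.natAbs) ((by omega : i.natAbs ≤ K).trans (hK _).le) h

end IsItinerary

variable (B) in
/-- The space of itineraries. -/
def itineraries : Set (ℕ → ℤ → ℕ × ℕ) := {t | B.IsItinerary t}

variable (B) in
/-- The families of addresses that satisfy the conditions of an itinerary up to level `N`. -/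
def partialItineraries (N : ℕ) : Set (ℕ → ℤ → ℕ × ℕ) :=
  {t | (∀ n i, B.IsFloor n (t n i)) ∧ (∀ n ≤ N, ∀ i, B.Follows n (t n i) (t n (i + 1))) ∧
    ∀ n < N, ∀ i, B.descend n (t (n + 1) i) = t n i}

theorem itineraries_eq_iInter : B.itineraries = ⋂ N, B.partialItineraries N := by
  ext t
  refine ⟨fun h => Set.mem_iInter.2 fun N => ⟨h.isFloor, fun n _ => h.follows n,
    fun n _ => h.descend n⟩, fun h => ?_⟩
  rw [Set.mem_iInter] at h
  exact ⟨(h 0).1, fun n => (h n).2.1 n le_rfl, fun n => (h (n + 1)).2.2 n n.lt_succ_self⟩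

theorem isClosed_setOf_rel {α : Type*} [TopologicalSpace α] [DiscreteTopology α]
    (R : α → α → Prop) (n m : ℕ) (i j : ℤ) :
    IsClosed {t : ℕ → ℤ → α | R (t n i) (t m j)} :=
  (isClosed_discrete {p : α × α | R p.1 p.2}).preimage
    (f := fun t : ℕ → ℤ → α => (t n i, t m j)) (by fun_prop)

theorem isClosed_partialItineraries (N : ℕ) : IsClosed (B.partialItineraries N) := by
  simp only [partialItineraries, Set.ofPred_and, Set.ofPred_forall]
  refine .inter ?_ (.inter ?_ ?_)
  · exact isClosed_iInter fun n => isClosed_iInter fun i =>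
      isClosed_setOf_rel (fun v _ => B.IsFloor n v) n n i i
  · exact isClosed_iInter fun n => isClosed_iInter fun _ => isClosed_iInter fun i =>
      isClosed_setOf_rel (B.Follows n) n n i (i + 1)
  · exact isClosed_iInter fun n => isClosed_iInter fun _ => isClosed_iInter fun i =>
      isClosed_setOf_rel (fun v w => B.descend n v = w) (n + 1) n i i

theorem finite_setOf_isFloor (n : ℕ) : {v | B.IsFloor n v}.Finite := by
  refine ((Set.finite_Iio (B.width n)).biUnion fun a _ =>
    (Set.finite_Iio (B.height n a)).image (Prod.mk a)).subset fun v hv => ?_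
  exact Set.mem_biUnion hv.1 ⟨v.2, hv.2, rfl⟩

theorem isCompact_partialItineraries (N : ℕ) : IsCompact (B.partialItineraries N) :=
  (isCompact_univ_pi fun n => isCompact_univ_pi fun _ =>
    (finite_setOf_isFloor n).isCompact).of_isClosed_subset (isClosed_partialItineraries N)
      fun _ ht n _ i _ => ht.1 n i

theorem isCompact_itineraries : IsCompact B.itineraries := by
  rw [itineraries_eq_iInter]
  exact (isCompact_partialItineraries 0).of_isClosed_subset
    (isClosed_iInter isClosed_partialItineraries) (Set.iInter_subset _ 0)

instance : CompactSpace B.itineraries := isCompact_iff_compactSpace.1 isCompact_itineraries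

theorem exists_mem_partialItineraries (N : ℕ) : ∀ {s : ℤ → ℕ × ℕ}, (∀ i, B.IsFloor N (s i)) →
    (∀ i, B.Follows N (s i) (s (i + 1))) → ∃ t ∈ B.partialItineraries N, t N = s := by
  induction N with
  | zero =>
    intro s hfloor hfollows
    refine ⟨Function.update (fun _ _ => (0, 0)) 0 s, ⟨fun n i => ?_, fun n hn i => ?_, by simp⟩,
      Function.update_self ..⟩
    · rcases eq_or_ne n 0 with rfl | hne
      · simpa using hfloor i
      · rw [Function.update_of_ne hne]
        exact ⟨B.width_pos n, B.height_pos n 0⟩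
    · obtain rfl := Nat.le_zero.1 hn
      simpa using hfollows i
  | succ N ih =>
    intro s hfloor hfollows
    obtain ⟨t, ⟨tfloor, tfollows, tdescend⟩, ht⟩ := ih (s := fun i => B.descend N (s i))
      (fun i => isFloor_descend N _) fun i => follows_descend_of_follows (hfloor i) (hfollows i)
    refine ⟨Function.update t (N + 1) s, ⟨fun n i => ?_, fun n hn i => ?_, fun n hn i => ?_⟩,
      Function.update_self ..⟩
    · rcases eq_or_ne n (N + 1) with rfl | hne
      · simpa using hfloor i
      · simpa [hne] using tfloor n i
    · rcases hn.lt_or_eq with hlt | rfl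
      · simpa [hlt.ne] using tfollows n (by omega) i
      · simpa using hfollows i
    · rcases (Nat.lt_succ_iff.1 hn).lt_or_eq with hlt | rfl
      · simpa [hlt.ne, hn.ne] using tdescend n hlt i
      · simp [ht]

theorem follows_emod (n : ℕ) (i : ℤ) :
    B.Follows n (0, (i % B.height n 0).toNat) (0, ((i + 1) % B.height n 0).toNat) := by
  have hheight := B.height_pos n 0
  have h0 := Int.emod_nonneg i (b := (B.height n 0 : ℤ)) (by omega)
  rw [← Int.emod_add_emod]
  refine ⟨fun h => ?_, fun h => ?_⟩
  · dsimp only at h ⊢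
    rw [Int.emod_eq_of_lt (by omega) (by omega), Int.toNat_add h0 zero_le_one, Int.toNat_one]
  · dsimp only at h ⊢
    rw [show i % (B.height n 0 : ℤ) + 1 = B.height n 0 by omega]
    simp

theorem itineraries_nonempty : B.itineraries.Nonempty := by
  rw [itineraries_eq_iInter]
  refine IsCompact.nonempty_iInter_of_sequence_nonempty_isCompact_isClosed _
    (fun N t ht => ⟨ht.1, fun n hn => ht.2.1 n (by omega), fun n hn => ht.2.2 n (by omega)⟩)
    (fun N => ?_) (isCompact_partialItineraries 0) isClosed_partialItineraries
  have hheight := B.height_pos N 0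
  obtain ⟨t, ht, -⟩ := exists_mem_partialItineraries (B := B) N
    (s := fun i => (0, (i % B.height N 0).toNat)) (fun i => ⟨B.width_pos N, by
      have := Int.emod_lt_of_pos i (b := (B.height N 0 : ℤ)) (by omega)
      dsimp only
      omega⟩) (follows_emod N)
  exact ⟨t, ht⟩

end TowerData

/-! ### The subshift of a tower diagram -/

theorem exists_forall_rel_imp_eq {X α ι : Type*} [TopologicalSpace X] [CompactSpace X]
    [TopologicalSpace α] [DiscreteTopology α] [Nonempty ι] [SemilatticeSup ι] {R : ι → Set (X × X)}
    (hclosed : ∀ k, IsClosed (R k)) (hanti : Antitone R)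
    (hdiag : ∀ p : X × X, (∀ k, p ∈ R k) → p.1 = p.2) {f : X → α} (hf : Continuous f) :
    ∃ k, ∀ p ∈ R k, f p.1 = f p.2 := by
  have hopen : IsOpen {p : X × X | f p.1 = f p.2} :=
    (isOpen_discrete {q : α × α | q.1 = q.2}).preimage
      (f := fun p : X × X => (f p.1, f p.2)) (by fun_prop)
  exact exists_subset_nhds_of_compactSpace hanti.directed_ge hclosed fun p hp =>
    hopen.mem_nhds (congrArg f (hdiag p (Set.mem_iInter.1 hp)))

namespace TowerData

variable {B : TowerData}

/-- An itinerary is determined by its level `0`, and the addresses in a given window at low levels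
are determined by the address at time `0` at each high level, where all bottom floors may be
confused. -/
structure Recognizable (B : TowerData) : Prop where
  eq_of_zero_eq : ∀ t t', B.IsItinerary t → B.IsItinerary t' → t 0 = t' 0 → t = t'
  eq_on_box : ∀ K : ℕ, ∃ N, ∀ n ≥ N, ∀ t t', B.IsItinerary t → B.IsItinerary t' →
    (t n 0 = t' n 0 ∨ ((t n 0).2 = 0 ∧ (t' n 0).2 = 0)) →
      ∀ m ≤ K, ∀ i : ℤ, |i| ≤ K → t m i = t' m i

variable (B) in
/-- The alphabet of the floors of level `0`. -/
abbrev Letter : Type := {v // B.IsFloor 0 v}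

instance : Finite B.Letter := finite_setOf_isFloor 0

/-- The sequence of the floors of level `0` that are visited by an itinerary. -/
def coding (t : B.itineraries) (i : ℤ) : B.Letter := ⟨t.1 0 i, t.2.isFloor 0 i⟩

theorem continuous_itineraries_apply (n : ℕ) (i : ℤ) :
    Continuous fun t : B.itineraries => t.1 n i :=
  (continuous_apply_apply n i).comp continuous_subtype_val

theorem continuous_coding : Continuous (coding (B := B)) :=
  continuous_pi fun i => (continuous_itineraries_apply 0 i).subtype_mk _

/-- The time translation of an itinerary. -/
def itineraryShift (k : ℤ) (t : B.itineraries) : B.itineraries :=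
  ⟨fun n i => t.1 n (k + i), t.2.shift k⟩

variable (B) in
/-- The subshift of the codings of all itineraries. -/
def subshift : Subshift B.Letter ℤ where
  carrier := Set.range coding
  isClosed := (isCompact_range continuous_coding).isClosed
  mapsTo := by
    rintro k _ ⟨t, rfl⟩
    exact ⟨itineraryShift k t, rfl⟩

instance : CompactSpace B.subshift.carrier :=
  isCompact_iff_compactSpace.1 (isCompact_range continuous_coding)

instance : Nonempty B.subshift.carrier :=
  have := (itineraries_nonempty (B := B)).to_subtype
  (Set.range_nonempty coding).to_subtype

theorem exists_eq_on_box_imp_eq (f : C(B.itineraries, ℤ)) : ∃ K : ℕ, ∀ t t' : B.itineraries,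
    (∀ m ≤ K, ∀ i : ℤ, |i| ≤ K → t.1 m i = t'.1 m i) → f t = f t' := by
  obtain ⟨K, hK⟩ := exists_forall_rel_imp_eq (ι := ℕ)
    (R := fun K : ℕ => {p : B.itineraries × B.itineraries |
      ∀ m ≤ K, ∀ i : ℤ, |i| ≤ K → p.1.1 m i = p.2.1 m i})
    (fun K => by
      simp only [Set.ofPred_forall]
      exact isClosed_iInter fun m => isClosed_iInter fun _ => isClosed_iInter fun i =>
        isClosed_iInter fun _ => isClosed_eq
          ((continuous_itineraries_apply m i).comp continuous_fst)
          ((continuous_itineraries_apply m i).comp continuous_snd))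
    (fun K L hKL p hp m hm i hi => hp m (hm.trans hKL) i (hi.trans (by exact_mod_cast hKL)))
    (fun p hp => Subtype.ext (funext fun m => funext fun i =>
      hp (max m i.natAbs) m (le_max_left _ _) i (by
        rw [Int.abs_eq_natAbs]
        exact_mod_cast le_max_right _ _)))
    f.continuous
  exact ⟨K, fun t t' => hK (t, t')⟩

namespace Recognizable

/-- The coding, as a homeomorphism. -/
def codingHomeomorph (hB : B.Recognizable) : B.itineraries ≃ₜ B.subshift.carrier :=
  Continuous.homeoOfEquivCompactToT2
    (f := Equiv.ofInjective coding fun t t' h => Subtype.ext <|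
      hB.eq_of_zero_eq _ _ t.2 t'.2 (funext fun i => congrArg Subtype.val (congrFun h i)))
    (continuous_coding.subtype_mk _)

theorem codingHomeomorph_symm_shiftMap (hB : B.Recognizable) (y : B.subshift.carrier) :
    hB.codingHomeomorph.symm (shiftMap B.subshift y) =
      itineraryShift 1 (hB.codingHomeomorph.symm y) := by
  obtain ⟨t, rfl⟩ := hB.codingHomeomorph.surjective y
  rw [Homeomorph.symm_apply_apply, Homeomorph.symm_apply_eq]
  rfl

/-- The floors of the towers partition the subshift. -/
def towerSystem (hB : B.Recognizable) : TowerSystem B (shiftMap B.subshift) where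
  addr n y := (hB.codingHomeomorph.symm y).1 n 0
  continuous_addr n := (continuous_itineraries_apply n 0).comp hB.codingHomeomorph.symm.continuous
  isFloor n y := (hB.codingHomeomorph.symm y).2.isFloor n 0
  follows n y := by
    rw [hB.codingHomeomorph_symm_shiftMap]
    exact (hB.codingHomeomorph.symm y).2.follows n 0
  descend_addr n y := (hB.codingHomeomorph.symm y).2.descend n 0
  separates f := by
    obtain ⟨K, hK⟩ :=
      exists_eq_on_box_imp_eq (f.comp (hB.codingHomeomorph : C(B.itineraries, B.subshift.carrier)))
    obtain ⟨N, hN⟩ := hB.eq_on_box K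
    refine ⟨N, fun n hn y y' h => ?_⟩
    simpa using hK _ _ (hN n hn _ _ (hB.codingHomeomorph.symm y).2
      (hB.codingHomeomorph.symm y').2 h)

end Recognizable

theorem Separating.lt_height (hB : B.Separating) : ∀ n a, n < B.height n a
  | 0, a => B.height_pos 0 a
  | n + 1, b => by
    rw [B.height_succ]
    calc n + 1 < 2 * (n + 1) := by omega
      _ ≤ ∑ a ∈ Finset.range (B.width n), (n + 1) := by
        simpa using Nat.mul_le_mul_right (n + 1) (hB.two_le_width n)
      _ ≤ ∑ a ∈ Finset.range (B.width n), B.mult n b a * B.height n a :=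
        Finset.sum_le_sum fun a _ => (Nat.succ_le_of_lt (lt_height hB n a)).trans
          (Nat.le_mul_of_pos_left _ (B.mult_pos n b a))

theorem sum_descend_bottom {n a : ℕ} (b : ℕ) (ha : a < B.width n) :
    ∑ j ∈ Finset.range (B.height (n + 1) b), (if B.descend n (b, j) = (a, 0) then 1 else 0) =
      B.mult n b a := by
  rw [sum_descend (fun v => if v = (a, 0) then 1 else 0)]
  simp [Prod.ext_iff, ite_and, ha, B.height_pos n a]

namespace IsItinerary

variable {t t' : ℕ → ℤ → ℕ × ℕ}

/-- Inside a tower of level `n + 1` the towers of level `n` occur in increasing order. -/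
theorem bottom_iff (ht : B.IsItinerary t) {n : ℕ} (hn : 2 ≤ B.width n) (i : ℤ) :
    (t (n + 1) i).2 = 0 ↔ (t n (i - 1)).1 = B.width n - 1 ∧ (t n i).1 = 0 := by
  refine ⟨fun h => ⟨?_, ?_⟩, fun ⟨htop, hbottom⟩ => ?_⟩
  · simpa using congrArg Prod.fst (ht.sub_of_bottom h (B.height_pos _ _))
  · simpa using congrArg Prod.fst (ht.add_of_bottom h (B.height_pos _ _))
  · by_contra hne
    obtain ⟨b, j, hbj⟩ : ∃ b j, t (n + 1) i = (b, j + 1) :=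
      ⟨_, _, Prod.ext rfl (Nat.succ_pred_eq_of_ne_zero hne).symm⟩
    rw [← ht.descend, ht.pred hbj] at htop
    rw [← ht.descend, hbj] at hbottom
    have hmono : B.towerAt n b j ≤ B.towerAt n b (j + 1) := towerAt_mono n b j.le_succ
    change B.towerAt n b j = _ at htop
    change B.towerAt n b (j + 1) = _ at hbottom
    omega

theorem snd_eq_of_bottom_iff (ht : B.IsItinerary t) (ht' : B.IsItinerary t') {n : ℕ}
    (h : ∀ i, (t n i).2 = 0 ↔ (t' n i).2 = 0) (i : ℤ) : (t n i).2 = (t' n i).2 := by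
  induction hj : (t n i).2 generalizing i with
  | zero => exact ((h i).1 hj).symm
  | succ j ih =>
    have hne : (t' n i).2 ≠ 0 := fun h' => by simp [(h i).2 h'] at hj
    obtain ⟨b, k, hbk⟩ : ∃ b k, t' n i = (b, k + 1) :=
      ⟨_, _, Prod.ext rfl (Nat.succ_pred_eq_of_ne_zero hne).symm⟩
    have := ih (i - 1) (by rw [ht.pred (Prod.ext rfl hj)])
    rw [ht'.pred hbk] at this
    rw [hbk, this]

theorem height_eq_of_bottom_iff (ht : B.IsItinerary t) (ht' : B.IsItinerary t') {n : ℕ}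
    (h : ∀ i, (t n i).2 = 0 ↔ (t' n i).2 = 0) (i : ℤ) :
    B.height n (t n i).1 = B.height n (t' n i).1 := by
  have hfloor := ht.isFloor n i
  obtain ⟨k, hk⟩ := Nat.exists_eq_add_of_lt hfloor.2
  have htop := ht.add (n := n) (i := i) rfl k (by omega)
  have hnext : (t' n (i + k + 1)).2 = 0 :=
    (h _).1 ((ht.follows n (i + k)).2 (by rw [htop]; exact hk.symm))
  have htop' := ht'.top_pred_of_bottom hnext
  have hsnd := ht.snd_eq_of_bottom_iff ht' h
  rw [add_sub_cancel_right, ← hsnd, htop] at htop'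
  have hback : t' n (i + k - k) = ((t' n (i + k)).1, (t n i).2) :=
    ht'.sub (Prod.ext rfl (by rw [← hsnd, htop]))
  rw [add_sub_cancel_right] at hback
  rw [hback, ← htop']
  exact hk

theorem level_succ_eq (ht : B.IsItinerary t) (ht' : B.IsItinerary t') (hB : B.Separating) {n : ℕ}
    (h : t n = t' n) : t (n + 1) = t' (n + 1) := by
  have hbottom : ∀ i, (t (n + 1) i).2 = 0 ↔ (t' (n + 1) i).2 = 0 := fun i => by
    rw [ht.bottom_iff (hB.two_le_width n), ht'.bottom_iff (hB.two_le_width n), h]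
  have hsnd := ht.snd_eq_of_bottom_iff ht' hbottom
  funext i
  refine Prod.ext ?_ (hsnd i)
  have hbase : t (n + 1) (i - (t (n + 1) i).2) = ((t (n + 1) i).1, 0) :=
    ht.sub (Prod.ext rfl (zero_add _).symm)
  have hbase' : t' (n + 1) (i - (t (n + 1) i).2) = ((t' (n + 1) i).1, 0) :=
    ht'.sub (Prod.ext rfl ((hsnd i).symm.trans (zero_add _).symm))
  refine hB.row_inj n _ (ht.isFloor _ _).1 _ (ht'.isFloor _ _).1 fun a ha => ?_
  have hheight := ht.height_eq_of_bottom_iff ht' hbottom i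
  rw [← sum_descend_bottom _ ha, ← sum_descend_bottom _ ha, ← hheight]
  refine Finset.sum_congr rfl fun j hj => ?_
  have hj := Finset.mem_range.1 hj
  have hfloor := ht.add hbase j (by omega)
  have hfloor' := ht'.add hbase' j (by omega)
  rw [zero_add] at hfloor hfloor'
  rw [← hfloor, ← hfloor', ht.descend, ht'.descend, h]

end IsItinerary

theorem Separating.recognizable (hB : B.Separating) : B.Recognizable where
  eq_of_zero_eq t t' ht ht' h := funext fun n => by
    induction n with
    | zero => exact h
    | succ n ih => exact ht.level_succ_eq ht' hB ih
  eq_on_box K := by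
    refine ⟨K + 1, fun n hn t t' ht ht' h m hm i hi => ?_⟩
    obtain ⟨n, rfl⟩ := Nat.exists_eq_add_of_le' (show 1 ≤ n by omega)
    exact ht.eq_of_le ht' (show m ≤ n by omega) (ht.eq_of_abs_le ht' h
      (fun a => (show K ≤ n by omega).trans_lt (hB.lt_height n a)) hi)

end TowerData

/-! ### Complexity -/

theorem ncard_le_card_of_rel {α β : Type*} [Fintype β] {s : Set α} {R : α → β → Prop}
    (hex : ∀ x ∈ s, ∃ y, R x y) (hinj : ∀ x ∈ s, ∀ x' ∈ s, ∀ y, R x y → R x' y → x = x') :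
    s.ncard ≤ Fintype.card β := by
  choose f hf using fun x : s => hex x x.2
  rw [← Nat.card_coe_set_eq, ← Nat.card_eq_fintype_card]
  exact Nat.card_le_card_of_injective f fun x x' h =>
    Subtype.ext (hinj x x.2 x' x'.2 (f x) (hf x) (h ▸ hf x'))

theorem forall_eq_or_exists_succ_ne {α : Type*} (f : ℕ → α) (m : ℕ) :
    (∀ i < m, f i = f 0) ∨ ∃ s, s + 1 < m ∧ f (s + 1) ≠ f s ∧ ∀ i ≤ s, f i = f 0 := by
  induction m with
  | zero => simp
  | succ m ih =>
    rcases ih with hconst | ⟨s, hs, h⟩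
    · rcases m with _ | m
      · simp
      by_cases hlast : f (m + 1) = f m
      · exact Or.inl fun i hi => (Nat.lt_succ_iff_lt_or_eq.1 hi).elim (hconst i) fun h => by
          rw [h, hlast, hconst m m.lt_succ_self]
      · exact Or.inr ⟨m, Nat.lt_succ_self _, hlast, fun i hi => hconst i (Nat.lt_succ_of_le hi)⟩
    · exact Or.inr ⟨s, hs.trans m.lt_succ_self, h⟩

namespace TowerData

variable {B : TowerData}

theorem complexity_subshift_le_card {β : Type*} [Fintype β] {m : ℕ}
    {R : (ℕ → ℤ → ℕ × ℕ) → β → Prop} (hex : ∀ t, B.IsItinerary t → ∃ y, R t y)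
    (heq : ∀ t t', B.IsItinerary t → B.IsItinerary t' → ∀ y, R t y → R t' y →
      ∀ i < m, t 0 i = t' 0 i) :
    complexity B.subshift m ≤ Fintype.card β := by
  refine ncard_le_card_of_rel (R := fun w y => ∃ t, B.IsItinerary t ∧ R t y ∧
    ∀ k : Fin m, (w k).1 = t 0 k) ?_ ?_
  · rintro w ⟨_, ⟨t, rfl⟩, i, hw⟩
    obtain ⟨y, hy⟩ := hex _ (t.2.shift i)
    exact ⟨y, _, t.2.shift i, hy, fun k => congrArg Subtype.val (hw k)⟩
  · rintro w - w' - y ⟨t, ht, hy, hw⟩ ⟨t', ht', hy', hw'⟩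
    exact funext fun k => Subtype.ext <|
      (hw k).trans ((heq t t' ht ht' y hy hy' k k.2).trans (hw' k).symm)

theorem Follows.eq_iff_eq {n : ℕ} {v v' w w' : ℕ × ℕ} (h : B.Follows n v w)
    (h' : B.Follows n v' w') (hv : B.IsFloor n v) (hv' : B.IsFloor n v') (hvv' : v.1 = v'.1)
    (hww' : w.1 = w'.1) : v = v' ↔ w = w' := by
  constructor
  · rintro rfl
    rcases (Nat.succ_le_of_lt hv.2).lt_or_eq with hlt | htop
    · exact (h.1 hlt).trans (h'.1 hlt).symm
    · exact Prod.ext hww' ((h.2 htop).trans (h'.2 htop).symm)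
  · rintro rfl
    refine Prod.ext hvv' ?_
    by_cases hw : w.2 = 0
    · have htop : ∀ {v}, B.IsFloor n v → B.Follows n v w → v.2 + 1 = B.height n v.1 :=
        fun hv h => (Nat.succ_le_of_lt hv.2).eq_or_lt.resolve_right fun hlt => by
          simp [h.1 hlt] at hw
      have h1 := htop hv h
      have h2 := htop hv' h'
      rw [hvv'] at h1
      omega
    · have := (h.eq_of_snd_ne_zero hv hw).symm.trans (h'.eq_of_snd_ne_zero hv' hw)
      exact Nat.succ_injective (congrArg Prod.snd this)

namespace IsItinerary

variable {t t' : ℕ → ℤ → ℕ × ℕ}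

theorem eq_on_window (ht : B.IsItinerary t) (ht' : B.IsItinerary t') {n m s : ℕ} (hs : s < m)
    (htower : ∀ i : ℕ, i < m → (t n i).1 = (t' n i).1) (h : t n s = t' n s) :
    ∀ i : ℕ, i < m → t n i = t' n i := by
  have eq_iff_eq_zero : ∀ i : ℕ, i < m → (t n i = t' n i ↔ t n 0 = t' n 0) := by
    intro i hi
    induction i with
    | zero => simp
    | succ i ih =>
      have hnext := htower (i + 1) hi
      rw [← ih (by omega)]
      push_cast at hnext ⊢
      exact ((ht.follows n i).eq_iff_eq (ht'.follows n i) (ht.isFloor n i) (ht'.isFloor n i)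
        (htower i (by omega)) hnext).symm
  exact fun i hi => (eq_iff_eq_zero i hi).2 ((eq_iff_eq_zero s hs).1 h)

theorem snd_eq_zero_of_fst_ne (ht : B.IsItinerary t) {n : ℕ} {i : ℤ}
    (h : (t n (i + 1)).1 ≠ (t n i).1) : (t n (i + 1)).2 = 0 := by
  by_contra hne
  exact h (by rw [(ht.follows n i).eq_of_snd_ne_zero (ht.isFloor n i) hne])

theorem eq_start_of_fst_ne (ht : B.IsItinerary t) {n : ℕ} {i : ℤ}
    (h : (t n (i + 1)).1 ≠ (t n i).1) : t (n + 1) (i + 1) =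
      ((t (n + 1) (i + 1)).1, B.start n (t (n + 1) (i + 1)).1 (t n (i + 1)).1) := by
  refine Prod.ext rfl ?_
  by_cases hbottom : (t (n + 1) (i + 1)).2 = 0
  · have hfirst := ht.add_of_bottom hbottom (B.height_pos n 0)
    rw [Nat.cast_zero, add_zero] at hfirst
    rw [hbottom, hfirst, start_zero]
  · have hsucc := (ht.follows (n + 1) i).eq_of_snd_ne_zero (ht.isFloor _ i) hbottom
    have hlt := (ht.isFloor (n + 1) (i + 1)).2
    rw [← ht.descend, ← ht.descend n i, hsucc] at h
    rw [← ht.descend n (i + 1), hsucc]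
    rw [hsucc] at hlt
    rcases descend_succ hlt with ⟨h', -⟩ | ⟨-, -, h', -⟩
    · exact absurd h' h
    · exact h'

theorem fst_add_of_fst_ne (ht : B.IsItinerary t) {n : ℕ} {i : ℤ}
    (h : (t n (i + 1)).1 ≠ (t n i).1) {e : ℕ}
    (he : e < B.mult n (t (n + 1) (i + 1)).1 (t n (i + 1)).1) :
    (t n (i + 1 + e)).1 = (t n (i + 1)).1 := by
  have hstart := ht.eq_start_of_fst_ne h
  have ha := (ht.isFloor n (i + 1)).1
  generalize (t (n + 1) (i + 1)).1 = b at hstart he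
  generalize (t n (i + 1)).1 = a at hstart he ha ⊢
  have he' := he.trans_le (Nat.le_mul_of_pos_right _ (B.height_pos n a))
  have hle := (start_strictMono (B := B) n b).monotone (Nat.succ_le_of_lt ha)
  rw [Nat.succ_eq_add_one, start_succ, start_width] at hle
  rw [← ht.descend, ht.add hstart e (by omega), descend_start_add ha he']

end IsItinerary

/-- The possible shapes of the window `[0, m)` of an itinerary: the tower of level `n` does not
change in it, or the tower of level `n` changes but that of level `n + 1` does not, or the latter
changes exactly once. The parameters are spelled out in `HasWindowCode`. -/
abbrev WindowCode (B : TowerData) (n m : ℕ) : Type :=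
  (Fin (B.width n) × Fin (∑ a ∈ Finset.range (B.width n), B.height n a)) ⊕
    (Fin (B.width (n + 1)) × Fin (B.width n) × Fin m) ⊕
      (Fin (B.width (n + 1)) × Fin (B.width (n + 1)) × Fin m)

/-- The itinerary `t` has the given shape in the window `[0, m)`. -/
def HasWindowCode (B : TowerData) (n m : ℕ) (t : ℕ → ℤ → ℕ × ℕ) : WindowCode B n m → Prop
  | .inl (a, r) => (∀ i : ℕ, i < m → (t n i).1 = a) ∧ t n 0 = (↑a, ↑r)
  | .inr (.inl (b, a, s)) =>
      (∀ i : ℕ, i < m → (t (n + 1) i).1 = b) ∧ t (n + 1) (s : ℕ) = (↑b, B.start n b a)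
  | .inr (.inr (b, c, s)) => (∀ i : ℕ, i < s → (t (n + 1) i).1 = b) ∧
      (∀ i : ℕ, ↑s ≤ i → i < m → (t (n + 1) i).1 = c) ∧ t (n + 1) (s : ℕ) = (↑c, 0)

theorem IsItinerary.exists_hasWindowCode {t : ℕ → ℤ → ℕ × ℕ} (ht : B.IsItinerary t) {n m : ℕ}
    (hm : ∀ b < B.width (n + 2), ∀ a < B.width (n + 1), m ≤ B.mult (n + 1) b a) :
    ∃ p, B.HasWindowCode n m t p := by
  rcases forall_eq_or_exists_succ_ne (fun i : ℕ => (t n i).1) m with hconst | ⟨s, hs, hne, -⟩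
  · obtain ⟨ha, hr⟩ := ht.isFloor n 0
    have hle := Finset.single_le_sum (f := B.height n) (fun _ _ => Nat.zero_le _)
      (Finset.mem_range.2 ha)
    exact ⟨.inl (⟨_, ha⟩, ⟨_, hr.trans_le hle⟩), hconst, rfl⟩
  rcases forall_eq_or_exists_succ_ne (fun i : ℕ => (t (n + 1) i).1) m with
    hconst | ⟨s', hs', hne', hbefore⟩
  · refine ⟨.inr (.inl (⟨_, (ht.isFloor (n + 1) 0).1⟩, ⟨_, (ht.isFloor n (s + 1)).1⟩,
      ⟨s + 1, hs⟩)), hconst, ?_⟩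
    have hb := hconst (s + 1) hs
    push_cast at hne hb ⊢
    rw [ht.eq_start_of_fst_ne hne, hb]
  · push_cast at hne'
    refine ⟨.inr (.inr (⟨_, (ht.isFloor (n + 1) 0).1⟩, ⟨_, (ht.isFloor (n + 1) (s' + 1)).1⟩,
      ⟨s' + 1, hs'⟩)), fun i hi => hbefore i (Nat.lt_succ_iff.1 hi), fun i hi him => ?_, ?_⟩
    · obtain ⟨e, rfl⟩ := Nat.exists_eq_add_of_le (show s' + 1 ≤ i from hi)
      have hrun := hm _ (ht.isFloor (n + 2) (s' + 1)).1 _ (ht.isFloor (n + 1) (s' + 1)).1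
      simpa using ht.fst_add_of_fst_ne hne' (e := e)
        ((show e < m by omega).trans_le hrun)
    · push_cast
      exact Prod.ext rfl (ht.snd_eq_zero_of_fst_ne hne')

theorem HasWindowCode.eq_on_window {n m : ℕ} {t t' : ℕ → ℤ → ℕ × ℕ} (ht : B.IsItinerary t)
    (ht' : B.IsItinerary t') {p : WindowCode B n m} (h : B.HasWindowCode n m t p)
    (h' : B.HasWindowCode n m t' p) (i : ℕ) (hi : i < m) : t 0 i = t' 0 i := by
  rcases p with ⟨a, r⟩ | ⟨b, a, s⟩ | ⟨b, c, s⟩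
  · exact ht.eq_of_le ht' (Nat.zero_le n) <| ht.eq_on_window ht' (s := 0) (by omega)
      (fun i hi => (h.1 i hi).trans (h'.1 i hi).symm) (h.2.trans h'.2.symm) i hi
  · exact ht.eq_of_le ht' (Nat.zero_le (n + 1)) <| ht.eq_on_window ht' s.2
      (fun i hi => (h.1 i hi).trans (h'.1 i hi).symm) (h.2.trans h'.2.symm) i hi
  · refine ht.eq_of_le ht' (Nat.zero_le (n + 1)) <|
      ht.eq_on_window ht' s.2 (fun i hi => ?_) (h.2.2.trans h'.2.2.symm) i hi
    rcases Nat.lt_or_ge i s with hlt | hge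
    · exact (h.1 i hlt).trans (h'.1 i hlt).symm
    · exact (h.2.1 i hge hi).trans (h'.2.1 i hge hi).symm

/-- A window that is not longer than the runs of level `n + 1` sees at most one change of the tower
of that level. -/
theorem complexity_subshift_le {n m : ℕ}
    (hm : ∀ b < B.width (n + 2), ∀ a < B.width (n + 1), m ≤ B.mult (n + 1) b a) :
    complexity B.subshift m ≤ B.width n * ∑ a ∈ Finset.range (B.width n), B.height n a +
      (B.width (n + 1) * (B.width n * m) + B.width (n + 1) * (B.width (n + 1) * m)) := by
  simpa [WindowCode] using complexity_subshift_le_card (R := B.HasWindowCode n m)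
    (fun t ht => ht.exists_hasWindowCode hm) fun t t' ht ht' _ => HasWindowCode.eq_on_window ht ht'

end TowerData

/-! ### Cyclic groups -/

/-- A single tower of height `m + 1` at every level: its only orbit is periodic. -/
def cyclicTowers (m : ℕ) : TowerData where
  width _ := 1
  mult _ _ _ := 1
  width_pos _ := one_pos
  mult_pos _ _ _ := one_pos
  height _ _ := m + 1
  height_zero_pos _ := m.succ_pos
  height_succ _ _ := by simp

namespace cyclicTowers

variable {m : ℕ} {t t' : ℕ → ℤ → ℕ × ℕ}

theorem fst_eq_zero (ht : (cyclicTowers m).IsItinerary t) (n : ℕ) (i : ℤ) : (t n i).1 = 0 :=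
  Nat.lt_one_iff.1 (ht.isFloor n i).1

theorem descend_mk {n j : ℕ} (hj : j < m + 1) : (cyclicTowers m).descend n (0, j) = (0, j) := by
  have := TowerData.descend_start_add (B := cyclicTowers m) (n := n) (b := 0) (a := 0) (s := j)
    one_pos (by simpa [cyclicTowers] using hj)
  rw [TowerData.start_zero, zero_add] at this
  exact this.trans (congrArg _ (Nat.mod_eq_of_lt hj))

theorem apply_eq_apply_zero (ht : (cyclicTowers m).IsItinerary t) (n : ℕ) (i : ℤ) :
    t n i = t 0 i := by
  induction n with
  | zero => rfl
  | succ n ih =>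
    have hmk : t (n + 1) i = (0, (t (n + 1) i).2) := Prod.ext (fst_eq_zero ht _ i) rfl
    have hdescend := ht.descend n i
    rw [hmk, descend_mk (ht.isFloor (n + 1) i).2] at hdescend
    exact hmk.trans (hdescend.trans ih)

theorem eq_of_snd_eq (ht : (cyclicTowers m).IsItinerary t)
    (ht' : (cyclicTowers m).IsItinerary t') (h : (t 0 0).2 = (t' 0 0).2) : t = t' := by
  have fst_eq : ∀ i, (t 0 i).1 = (t' 0 i).1 := fun i => by rw [fst_eq_zero ht, fst_eq_zero ht']
  have eq_iff_succ : ∀ i, t 0 i = t' 0 i ↔ t 0 (i + 1) = t' 0 (i + 1) := fun i =>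
    (ht.follows 0 i).eq_iff_eq (ht'.follows 0 i) (ht.isFloor 0 i) (ht'.isFloor 0 i) (fst_eq i)
      (fst_eq (i + 1))
  funext n i
  rw [apply_eq_apply_zero ht, apply_eq_apply_zero ht']
  induction i with
  | zero => exact Prod.ext (fst_eq 0) h
  | succ i ih => exact (eq_iff_succ i).1 ih
  | pred i ih => exact (eq_iff_succ _).2 (by simpa using ih)

theorem recognizable (m : ℕ) : (cyclicTowers m).Recognizable where
  eq_of_zero_eq _ _ ht ht' h := eq_of_snd_eq ht ht' (by rw [h])
  eq_on_box K := by
    refine ⟨0, fun n _ t t' ht ht' h _ _ _ _ => ?_⟩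
    rw [apply_eq_apply_zero ht, apply_eq_apply_zero ht'] at h
    rw [eq_of_snd_eq ht ht' (h.elim (congrArg Prod.snd) fun h => h.1.trans h.2.symm)]

theorem complexity_le (m n : ℕ) : complexity (cyclicTowers m).subshift n ≤ m + 1 := by
  rw [← Fintype.card_fin (m + 1)]
  exact TowerData.complexity_subshift_le_card (R := fun t r => (t 0 0).2 = (r : ℕ))
    (fun t ht => ⟨⟨_, (ht.isFloor 0 0).2⟩, rfl⟩)
    fun t t' ht ht' r hr hr' i _ => by rw [eq_of_snd_eq ht ht' (hr.trans hr'.symm)]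

end cyclicTowers

namespace BratteliDiagram.Represents

variable {B : BratteliDiagram} {M : Type*} [AddCommGroup M] {γ : ℕ → ℕ → M} {P : Set M}

theorem exists_generator (h : B.Represents γ P) (hB : ¬ B.Growing) :
    ∃ e : M, (∀ g, ∃ c : ℤ, (g ∈ P → 0 ≤ c) ∧ c • e = g) ∧ (∀ c : ℤ, 0 ≤ c → c • e ∈ P) ∧
      ∀ c : ℤ, c • e = 0 → c = 0 := by
  obtain ⟨n₀, hn₀⟩ := exists_width_eq_one_of_not_growing hB
  have gen_eq : ∀ n ≥ n₀, γ n 0 = γ n₀ 0 := fun n hn => by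
    induction n, hn using Nat.le_induction with
    | base => rfl
    | succ n hn ih =>
      rw [← ih, h.compatible n 0 (B.width_pos n)]
      simp [(hn₀ n hn).2, (hn₀ (n + 1) (by omega)).1]
  have eval_eq : ∀ n ≥ n₀, ∀ x, B.eval γ n x = x 0 • γ n₀ 0 := fun n hn x => by
    simp [eval_apply, (hn₀ n hn).1, gen_eq n hn]
  refine ⟨γ n₀ 0, fun g => ?_, fun c hc => ?_, fun c hc => ?_⟩
  · obtain ⟨n, ⟨x, hx, hxg⟩, hn⟩ :=
      ((h.eventually_exists_eval_eq g).and (eventually_ge_atTop n₀)).exists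
    exact ⟨x 0, fun hg => hx hg 0 (B.width_pos n), by rw [← eval_eq n hn, hxg]⟩
  · exact (h.mem_iff _).2 ⟨n₀, fun _ => c, fun _ _ => hc, eval_eq n₀ le_rfl _⟩
  · by_contra hne
    refine (h.pos_of_mem_lowerCone_one
      ⟨fun _ => |c|, fun _ _ => Int.one_le_abs hne, eval_eq n₀ le_rfl _⟩).2 ?_
    rcases abs_choice c with hc' | hc' <;> simp [hc', hc]

theorem exists_cyclicTowers (h : B.Represents γ P) (hB : ¬ B.Growing) {u : M} (hu : u ∈ P)
    (hu0 : u ≠ 0) : ∃ (m : ℕ) (γ' : ℕ → ℕ → M), (cyclicTowers m).Represents γ' P ∧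
      u = (cyclicTowers m).eval γ' 0 fun a => (cyclicTowers m).height 0 a := by
  obtain ⟨e, hgen, hpos, hfree⟩ := h.exists_generator hB
  obtain ⟨c, hc, rfl⟩ := hgen u
  obtain ⟨k, rfl⟩ := Int.eq_ofNat_of_zero_le (hc hu)
  obtain ⟨m, rfl⟩ := Nat.exists_eq_succ_of_ne_zero (n := k) fun hk => hu0 (by simp [hk])
  have eval_eq : ∀ n x, (cyclicTowers m).eval (fun _ _ => e) n x = x 0 • e := fun n x => by
    simp [BratteliDiagram.eval_apply, cyclicTowers]
  refine ⟨m, fun _ _ => e, ⟨fun n a _ => ?_, fun g => ?_, fun g => ⟨fun hg => ?_, ?_⟩,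
    fun n x hx => ⟨0, fun b hb => ?_⟩⟩,
    (eval_eq 0 fun a => ((cyclicTowers m).height 0 a : ℤ)).symm⟩
  · simp [cyclicTowers]
  · obtain ⟨c, -, rfl⟩ := hgen g
    exact ⟨0, fun _ => c, eval_eq 0 _⟩
  · obtain ⟨c, hc, rfl⟩ := hgen g
    exact ⟨0, fun _ => c, fun _ _ => hc hg, eval_eq 0 _⟩
  · rintro ⟨n, x, hx, rfl⟩
    rw [eval_eq]
    exact hpos _ (hx 0 one_pos)
  · obtain rfl := Nat.lt_one_iff.1 hb
    exact hfree _ ((eval_eq n x).symm.trans hx)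

theorem ne_zero_of_isOrderUnit (h : B.Represents γ P) (hP : IsOrderedGroup P) {u : M}
    (hu : IsOrderUnit P u) : u ≠ 0 := by
  rintro rfl
  obtain ⟨hg, hg0⟩ := h.generator_pos (B.width_pos 0)
  obtain ⟨k, hk⟩ := hu.2 (γ 0 0)
  rw [smul_zero, zero_sub] at hk
  exact hg0 ((hP.mem_and_neg_mem _).1 ⟨hg, hk⟩)

end BratteliDiagram.Represents

/-! ### Asymptotics -/

section Asymptotics

variable {p : ℕ → ℝ} {c : ℕ → ℕ}

theorem tendsto_div_zero_iff (hp : ∀ n, 0 < p n) :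
    Tendsto (fun n => (c n : ℝ) / p n) atTop (𝓝 0) ↔
      ∀ k : ℕ, ∀ᶠ n in atTop, (k : ℝ) * c n ≤ p n := by
  rw [← Asymptotics.isLittleO_iff_tendsto fun n hn => absurd hn (hp n).ne',
    Asymptotics.isLittleO_iff_nat_mul_le]
  simp [abs_of_pos (hp _)]

theorem tendsto_div_zero_of_le (hp : ∀ n, 0 < p n)
    (hlim : Tendsto (fun n : ℕ => (n : ℝ) / p n) atTop (𝓝 0)) {m : ℕ} (hc : ∀ n, c n ≤ m) :
    Tendsto (fun n => (c n : ℝ) / p n) atTop (𝓝 0) := by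
  refine (tendsto_div_zero_iff hp).2 fun k => ?_
  filter_upwards [(tendsto_div_zero_iff hp).1 hlim (k * m), eventually_ge_atTop 1] with n hn hn1
  refine le_trans ?_ hn
  have := Nat.mul_le_mul_left k ((hc n).trans (Nat.le_mul_of_pos_right m hn1))
  rw [← mul_assoc] at this
  exact_mod_cast this

theorem eventually_exists_lt_le {N : ℕ → ℕ} (hN : ∀ n, n ≤ N n) (n₀ : ℕ) :
    ∀ᶠ m in atTop, ∃ n ≥ n₀, N n < m ∧ m ≤ N (n + 1) := by
  filter_upwards [(Finset.range (n₀ + 1)).eventually_all.2 fun j _ => eventually_gt_atTop (N j)]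
    with m hm
  have hex : ∃ n, m ≤ N n := ⟨m, hN m⟩
  have hlt : n₀ < Nat.find hex := by
    by_contra! hle
    exact (hm _ (Finset.mem_range.2 (Nat.lt_succ_of_le hle))).not_ge (Nat.find_spec hex)
  obtain ⟨n, hn⟩ := Nat.exists_eq_succ_of_ne_zero (Nat.ne_zero_of_lt hlt)
  exact ⟨n, by omega, not_le.1 (Nat.find_min hex (by omega)),
    (Nat.find_spec hex).trans_eq (congrArg N hn)⟩

theorem tendsto_div_zero_of_block_le (hp : ∀ n, 0 < p n) {N : ℕ → ℕ} (hN : ∀ n, n ≤ N n)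
    (hc : ∀ n m, N n < m → m ≤ N (n + 1) → (n : ℝ) * c m ≤ p m) :
    Tendsto (fun n => (c n : ℝ) / p n) atTop (𝓝 0) := by
  refine (tendsto_div_zero_iff hp).2 fun k => ?_
  filter_upwards [eventually_exists_lt_le hN k] with m ⟨n, hkn, hlt, hle⟩
  exact (mul_le_mul_of_nonneg_right (by exact_mod_cast hkn) (Nat.cast_nonneg _)).trans
    (hc n m hlt hle)

end Asymptotics

theorem exists_threshold_tendsto_complexity {p : ℕ → ℝ} (hp : ∀ n, 0 < p n)
    (hlim : Tendsto (fun n : ℕ => (n : ℝ) / p n) atTop (𝓝 0)) :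
    ∃ Φ : ℕ → ℕ → (ℕ → ℕ) → ℕ → ℕ, ∀ B : TowerData,
      (∀ n b a, Φ n (B.width n) (B.height n) (B.width (n + 1)) ≤ B.mult n b a) →
        Tendsto (fun n => (complexity B.subshift n : ℝ) / p n) atTop (𝓝 0) := by
  choose T hT using fun C => eventually_atTop.1 ((tendsto_div_zero_iff hp).1 hlim C)
  let C : ℕ → ℕ → ℕ := fun k k' => 1 + k' * k + k' * k'
  let Φ : ℕ → ℕ → (ℕ → ℕ) → ℕ → ℕ := fun n k h k' =>
    k * ∑ a ∈ Finset.range k, h a + n + T (n * C k k')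
  refine ⟨Φ, fun B hB => tendsto_div_zero_of_block_le hp
    (N := fun n => Φ n (B.width n) (B.height n) (B.width (n + 1)))
    (fun n => by simp only [Φ]; omega) fun n m hlt hle => ?_⟩
  simp only [Φ] at hlt
  have hlinear : complexity B.subshift m ≤ C (B.width n) (B.width (n + 1)) * m :=
    calc complexity B.subshift m ≤ _ :=
          TowerData.complexity_subshift_le fun b _ a _ => hle.trans (hB (n + 1) b a)
      _ ≤ m + (B.width (n + 1) * (B.width n * m) + B.width (n + 1) * (B.width (n + 1) * m)) :=
          Nat.add_le_add_right (by omega) _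
      _ = C (B.width n) (B.width (n + 1)) * m := by simp only [C]; ring
  calc (n : ℝ) * complexity B.subshift m ≤ (n * C (B.width n) (B.width (n + 1)) : ℕ) * m := by
        exact_mod_cast (Nat.mul_le_mul_left n hlinear).trans_eq (mul_assoc _ _ _).symm
    _ ≤ p m := hT _ m (by omega)

end DimGroup

end

theorem theorem1 {G : Type*} [AddCommGroup G] (Gp : Set G) (u : G)
    (hG : DimGroup.IsSimpleDimensionGroup Gp) (hu : DimGroup.IsOrderUnit Gp u)
    (p : ℕ → ℝ) (hp : ∀ n, 0 < p n)
    (hlim : Tendsto (fun n : ℕ => (n : ℝ) / p n) atTop (𝓝 0)) :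
    ∃ (𝒜 : Type) (_ : Fintype 𝒜) (_ : TopologicalSpace 𝒜) (_ : DiscreteTopology 𝒜)
      (Y : Subshift 𝒜 ℤ),
      DimGroup.IsMinimalSystem (DimGroup.shiftMap Y) ∧
      DimGroup.OrderedUnitIso
        (DimGroup.K0.pos (DimGroup.shiftMap Y)) (DimGroup.K0.unit (DimGroup.shiftMap Y)) Gp u ∧
      Tendsto (fun n : ℕ => (DimGroup.complexity Y n : ℝ) / p n) atTop (𝓝 0) := by
  obtain ⟨B, γ, h⟩ := hG.exists_represents
  have hO : DimGroup.IsOrderedGroup Gp := hG.1.1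
  have hu0 : u ≠ 0 := h.ne_zero_of_isOrderUnit hO hu
  obtain ⟨B', γ', hrec, h', rfl, htend⟩ : ∃ (B' : DimGroup.TowerData) (γ' : ℕ → ℕ → G),
      B'.Recognizable ∧ B'.Represents γ' Gp ∧ u = B'.eval γ' 0 (fun a => B'.height 0 a) ∧
        Tendsto (fun n => (DimGroup.complexity B'.subshift n : ℝ) / p n) atTop (𝓝 0) := by
    by_cases hB : B.Growing
    · obtain ⟨Φ, hΦ⟩ := DimGroup.exists_threshold_tendsto_complexity hp hlim
      obtain ⟨B', γ', hsep, h', hunit, hle⟩ := h.exists_towerData hB hO hu.1 hu0 Φ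
      exact ⟨B', γ', hsep.recognizable, h', hunit, hΦ B' hle⟩
    · obtain ⟨m, γ', h', hunit⟩ := h.exists_cyclicTowers hB hu.1 hu0
      exact ⟨DimGroup.cyclicTowers m, γ', DimGroup.cyclicTowers.recognizable m, h', hunit,
        DimGroup.tendsto_div_zero_of_le hp hlim (DimGroup.cyclicTowers.complexity_le m)⟩
  exact ⟨B'.Letter, Fintype.ofFinite _, inferInstance, inferInstance, B'.subshift,
    hrec.towerSystem.isMinimalSystem, hrec.towerSystem.orderedUnitIso h', htend⟩
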